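/- **Conventions.** Finite types are generated from the type $0$ of natural numbers by $\rho\to\tau$ and $\rho^{*}$ (finite sequences of objects of type $\rho$); $1=0\to0$, $2=1\to 0$. $\textsf{E-PRA}^{\omega*}$ is the classical theory in all finite types with $=_0$ as only primitive equality (equality at higher types is defined extensionally; sequences are equal if they have the same length and components), the axiom of extensionality, the successor axioms, the combinators $\Pi,\Sigma$, the recursor $R_0$ of type $0$, induction for quantifier-free formulas, and the defining axioms for length, components and formation $\langle f(0),\dots ,f(n-1)\rangle$ of finite sequences. A formula is *internal* if it does not contain the standardness predicates $\mathrm{st}_\sigma$; $(\forall^{\mathrm{st}}x)$, $(\exists^{\mathrm{st}}x)$ are the quantifiers relativised to $\mathrm{st}$; $N\in\Omega$ means $\neg\mathrm{st}(N)$; and $q\in Q^{\rho^*}$ means $(\exists i<|Q|)(Q(i)=_\rho q)$. The theory $\textsf{P}_0$ (in the language with $\mathrm{st}$) consists of $\textsf{E-PRA}^{\omega*}$ and the following axioms: * $\mathrm{st}(x)\wedge x=y\to \mathrm{st}(y)$; $\mathrm{st}(t)$ for each closed term $t$ of the internal language; $\mathrm{st}(f)\wedge\mathrm{st}(x)\to\mathrm{st}(f(x))$;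 * standard numbers are finite: $\mathrm{st}(m)\wedge n\le_0 m\to\mathrm{st}(n)$; * $\textsf{HAC}_{\textsf{int}}$: $(\forall^{\mathrm{st}}x^\rho)(\exists^{\mathrm{st}}y^\tau)\varphi(x,y)\to(\exists^{\mathrm{st}}F^{\rho\to\tau^*})(\forall^{\mathrm{st}}x^\rho)(\exists y^\tau\in F(x))\varphi(x,y)$, for internal $\varphi$; * $\textsf{I}$: $(\forall^{\mathrm{st}}x^{\sigma^*})(\exists y^\tau)(\forall z^\sigma\in x)\varphi(z,y)\to(\exists y^\tau)(\forall^{\mathrm{st}}x^\sigma)\varphi(x,y)$, for internal $\varphi$; * $\textsf{QF-AC}^{1,0}$: $(\forall x^1)(\exists y^0)\varphi(x,y)\to(\exists F^{2})(\forall x^1)\varphi(x,F(x))$, for quantifier-free internal $\varphi$. Each object of type $1$ represents a real number as a fast-converging Cauchy sequence of (codes of) rationals via the hat function: $\hat f(n)=f(k)$ for the least $k<n$ with $|f(k)-f(k+1)|\geq 2^{-k-1}$ if there is one, and $\hat f(n)=f(n)$ otherwise. For reals $x,y$, $x\le y$ means $(\forall n)(\hat x(n+1)-\hat y(n+1)<2^{-n})$;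 $|x-y|\le\frac1k$ means $(\forall n)(|\hat x(n+1)-\hat y(n+1)|<\frac1k+2^{-n})$, which is read as true for $k=0$; and $x\approx y$ means $(\forall^{\mathrm{st}}k^0)(|x-y|\le\frac1k)$. Put $$\Pi^0_1\textsf{-TRANS}:\quad (\forall^{\mathrm{st}}f^1)\big[(\forall^{\mathrm{st}}n)f(n)\neq0\to(\forall m)f(m)\ne0\big],$$ $$\textsf{MCT}_{\textsf{ns}}:\quad (\forall^{\mathrm{st}}c_{(\cdot)}^{0\to1})\big[(\forall n)(c_n\le c_{n+1}\le1)\to(\forall N,M\in\Omega)(c_M\approx c_N)\big],$$ $$A(f^1,n^0):\quad (\exists m)f(m)=0\to(\exists i\le n)f(i)=0,$$ $$B(c_{(\cdot)}^{0\to1},k^0,m^0):\quad (\forall n)(c_n\le c_{n+1}\le1)\to(\forall N,M\ge m)\big(|c_M-c_N|\le\tfrac1k\big).$$ For tuples $s=(s_1,s_2,s_3)$ and $t=(t_1,t_2)$ of closed terms of the internal language (of the appropriate types) let $\textsf{MTE}_{\textsf{her}}(s,t)$ be the conjunction of $$(\forall c_{(\cdot)}^{0\to1},k^0,\mu^2)(\exists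 m^0\in t_1(\mu,c_{(\cdot)},k))(\exists f^1\in t_2(\mu,c_{(\cdot)},k))\big[A(f,\mu(f))\to B(c_{(\cdot)},k,m)\big]$$ and $$(\forall f^1,g^{(0\to1)\to1})(\exists m^0\in s_1(f,g))(\exists c_{(\cdot)}^{0\to1}\in s_2(f,g))(\exists k^0\in s_3(f,g))\big[B(c_{(\cdot)},k,g(c_{(\cdot)})(k))\to A(f,m)\big].$$ **Corollary 4.2.** Let $s$, $t$ be such tuples of closed terms of the internal language. Then any proof in $\textsf{E-PRA}^{\omega*}$ of $\textsf{MTE}_{\textsf{her}}(s,t)$ can be converted into a proof in $\textsf{P}_0$ of $\Pi^0_1\textsf{-TRANS}\leftrightarrow\textsf{MCT}_{\textsf{ns}}$. -/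

import Mathlib

namespace Herb

/-! ### Finite types, terms -/

/-- Finite types over the natural numbers, closed under function types and
types `ρ*` of finite sequences of objects of type `ρ`. -/
inductive Ty : Type
  | nat : Ty
  | arr : Ty → Ty → Ty
  | seq : Ty → Ty

infixr:60 " ⇒ " => Ty.arr

/-- Type `0`. -/
abbrev T0 : Ty := Ty.nat
/-- Type `1`. -/
abbrev T1 : Ty := T0 ⇒ T0
/-- Type `2`. -/
abbrev T2 : Ty := T1 ⇒ T0
/-- Type `0 → 1` (sequences of reals). -/
abbrev TS : Ty := T0 ⇒ T1

/-- Contexts: the types of the free variables, innermost first. -/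
abbrev Ctx : Type := List Ty

/-- Typed de Bruijn variables. -/
inductive Var : Ctx → Ty → Type
  | vz {Γ : Ctx} {σ : Ty} : Var (σ :: Γ) σ
  | vs {Γ : Ctx} {σ τ : Ty} : Var Γ τ → Var (σ :: Γ) τ

/-- Constants: zero, successor, the combinators `Π` and `Σ`, the recursor `R₀` of type `0` only,
and for finite sequences: length, components, and the operation `n, f ↦ ⟨f(0), …, f(n-1)⟩`. -/
inductive Con : Ty → Type
  | zero : Con T0
  | succ : Con (T0 ⇒ T0)
  | kk (σ τ : Ty) : Con (σ ⇒ τ ⇒ σ)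
  | ss (ρ σ τ : Ty) : Con ((ρ ⇒ σ ⇒ τ) ⇒ (ρ ⇒ σ) ⇒ ρ ⇒ τ)
  | rr : Con (T0 ⇒ T0 ⇒ (T0 ⇒ T0 ⇒ T0) ⇒ T0)
  | len (σ : Ty) : Con (Ty.seq σ ⇒ T0)
  | get (σ : Ty) : Con (Ty.seq σ ⇒ T0 ⇒ σ)
  | mk (σ : Ty) : Con (T0 ⇒ (T0 ⇒ σ) ⇒ Ty.seq σ)

/-- Terms of the (internal) language; closed terms are the terms in the empty context. -/
inductive Tm : Ctx → Ty → Type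
  | var {Γ : Ctx} {σ : Ty} : Var Γ σ → Tm Γ σ
  | con {Γ : Ctx} {σ : Ty} : Con σ → Tm Γ σ
  | app {Γ : Ctx} {σ τ : Ty} : Tm Γ (σ ⇒ τ) → Tm Γ σ → Tm Γ τ

infixl:75 " ⬝ " => Tm.app

/-- Renamings of variables. -/
abbrev Ren (Γ Δ : Ctx) : Type := ∀ τ : Ty, Var Γ τ → Var Δ τ

/-- Simultaneous substitutions. -/
abbrev Sub (Γ Δ : Ctx) : Type := ∀ τ : Ty, Var Γ τ → Tm Δ τ

def Ren.lift {Γ Δ : Ctx} (r : Ren Γ Δ) (σ : Ty) : Ren (σ :: Γ) (σ :: Δ)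
  | _, Var.vz => Var.vz
  | _, Var.vs v => Var.vs (r _ v)

def Ren.wk {Γ : Ctx} (σ : Ty) : Ren Γ (σ :: Γ) := fun _ v => Var.vs v

def Ren.empty {Γ : Ctx} : Ren [] Γ := fun _ v => nomatch v

def Tm.ren {Γ Δ : Ctx} (r : Ren Γ Δ) : {σ : Ty} → Tm Γ σ → Tm Δ σ
  | _, Tm.var v => Tm.var (r _ v)
  | _, Tm.con c => Tm.con c
  | _, Tm.app t u => Tm.app (t.ren r) (u.ren r)

def Tm.sub {Γ Δ : Ctx} (s : Sub Γ Δ) : {σ : Ty} → Tm Γ σ → Tm Δ σ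
  | _, Tm.var v => s _ v
  | _, Tm.con c => Tm.con c
  | _, Tm.app t u => Tm.app (t.sub s) (u.sub s)

/-- Weakening by one variable. -/
abbrev Tm.wk {Γ : Ctx} {σ : Ty} (ρ : Ty) (t : Tm Γ σ) : Tm (ρ :: Γ) σ := t.ren (Ren.wk ρ)

/-- A closed term, seen in any context. -/
abbrev Tm.cl {Γ : Ctx} {σ : Ty} (t : Tm [] σ) : Tm Γ σ := t.ren Ren.empty

def Sub.lift {Γ Δ : Ctx} (s : Sub Γ Δ) (σ : Ty) : Sub (σ :: Γ) (σ :: Δ)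
  | _, Var.vz => Tm.var Var.vz
  | _, Var.vs v => (s _ v).wk σ

/-- Substitution of `t` for the innermost variable. -/
def Sub.one {Γ : Ctx} {σ : Ty} (t : Tm Γ σ) : Sub (σ :: Γ) Γ
  | _, Var.vz => t
  | _, Var.vs v => Tm.var v

/-! Variables, counted from the innermost one. -/

abbrev x0 {Γ : Ctx} {a : Ty} : Tm (a :: Γ) a := Tm.var Var.vz
abbrev x1 {Γ : Ctx} {a b : Ty} : Tm (a :: b :: Γ) b := Tm.var (Var.vs Var.vz)
abbrev x2 {Γ : Ctx} {a b c : Ty} : Tm (a :: b :: c :: Γ) c :=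
  Tm.var (Var.vs (Var.vs Var.vz))
abbrev x3 {Γ : Ctx} {a b c d : Ty} : Tm (a :: b :: c :: d :: Γ) d :=
  Tm.var (Var.vs (Var.vs (Var.vs Var.vz)))
abbrev x4 {Γ : Ctx} {a b c d e : Ty} : Tm (a :: b :: c :: d :: e :: Γ) e :=
  Tm.var (Var.vs (Var.vs (Var.vs (Var.vs Var.vz))))

/-- Removes the innermost variable from the context, if it does not occur. -/
def Tm.str {Γ : Ctx} {σ : Ty} : {τ : Ty} → Tm (σ :: Γ) τ → Option (Tm Γ τ)
  | _, Tm.var Var.vz => none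
  | _, Tm.var (Var.vs v) => some (Tm.var v)
  | _, Tm.con c => some (Tm.con c)
  | _, Tm.app t u =>
      match t.str, u.str with
      | some t', some u' => some (t' ⬝ u')
      | _, _ => none

/-- The usual definition of lambda abstraction from the combinators `Π` and `Σ`:
`λx.x = ΣΠΠ`, `λx.t = Πt` if `x` does not occur in `t`, and `λx.tu = Σ(λx.t)(λx.u)` otherwise. -/
def lam {Γ : Ctx} {σ : Ty} : {τ : Ty} → Tm (σ :: Γ) τ → Tm Γ (σ ⇒ τ)
  | _, Tm.var Var.vz =>
      Tm.con (Con.ss σ (σ ⇒ σ) σ) ⬝ Tm.con (Con.kk σ (σ ⇒ σ)) ⬝ Tm.con (Con.kk σ σ)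
  | τ, Tm.var (Var.vs v) => Tm.con (Con.kk τ σ) ⬝ Tm.var v
  | τ, Tm.con c => Tm.con (Con.kk τ σ) ⬝ Tm.con c
  | τ, Tm.app t u =>
      match (Tm.app t u).str with
      | some w => Tm.con (Con.kk τ σ) ⬝ w
      | none => Tm.con (Con.ss _ _ _) ⬝ lam t ⬝ lam u

def zero {Γ : Ctx} : Tm Γ T0 := Tm.con Con.zero
def succ {Γ : Ctx} (t : Tm Γ T0) : Tm Γ T0 := Tm.con Con.succ ⬝ t
def recr {Γ : Ctx} (n a : Tm Γ T0) (h : Tm Γ (T0 ⇒ T0 ⇒ T0)) : Tm Γ T0 :=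
  Tm.con Con.rr ⬝ n ⬝ a ⬝ h
def len {Γ : Ctx} {σ : Ty} (s : Tm Γ (Ty.seq σ)) : Tm Γ T0 := Tm.con (Con.len σ) ⬝ s
def get {Γ : Ctx} {σ : Ty} (s : Tm Γ (Ty.seq σ)) (i : Tm Γ T0) : Tm Γ σ :=
  Tm.con (Con.get σ) ⬝ s ⬝ i
def mkSeq {Γ : Ctx} {σ : Ty} (n : Tm Γ T0) (f : Tm Γ (T0 ⇒ σ)) : Tm Γ (Ty.seq σ) :=
  Tm.con (Con.mk σ) ⬝ n ⬝ f

/-- The zero object of each type. -/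
def zeroObj {Γ : Ctx} : (σ : Ty) → Tm Γ σ
  | Ty.nat => zero
  | Ty.arr σ τ => Tm.con (Con.kk τ σ) ⬝ zeroObj τ
  | Ty.seq σ => mkSeq zero (Tm.con (Con.kk σ T0) ⬝ zeroObj σ)

/-! ### Primitive recursive arithmetic, as closed terms -/

@[irreducible] def addC : Tm [] (T0 ⇒ T0 ⇒ T0) := lam (lam (recr x0 x1 (lam (lam (succ x1)))))
def add {Γ : Ctx} (a b : Tm Γ T0) : Tm Γ T0 := addC.cl ⬝ a ⬝ b

@[irreducible] def mulC : Tm [] (T0 ⇒ T0 ⇒ T0) := lam (lam (recr x0 zero (lam (lam (add x1 x3)))))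
def mul {Γ : Ctx} (a b : Tm Γ T0) : Tm Γ T0 := mulC.cl ⬝ a ⬝ b

/-- Predecessor. -/
@[irreducible] def predC : Tm [] (T0 ⇒ T0) := lam (recr x0 zero (lam (lam x0)))
def pred {Γ : Ctx} (a : Tm Γ T0) : Tm Γ T0 := predC.cl ⬝ a

/-- Truncated subtraction. -/
@[irreducible] def subC : Tm [] (T0 ⇒ T0 ⇒ T0) := lam (lam (recr x0 x1 (lam (lam (pred x1)))))
def tsub {Γ : Ctx} (a b : Tm Γ T0) : Tm Γ T0 := subC.cl ⬝ a ⬝ b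

/-- `|a - b|`. -/
def dist {Γ : Ctx} (a b : Tm Γ T0) : Tm Γ T0 := add (tsub a b) (tsub b a)

/-- `2 ^ n`. -/
@[irreducible] def pow2C : Tm [] (T0 ⇒ T0) := lam (recr x0 (succ zero) (lam (lam (add x1 x1))))
def pow2 {Γ : Ctx} (a : Tm Γ T0) : Tm Γ T0 := pow2C.cl ⬝ a

/-- `if c = 0 then a else b`. -/
@[irreducible] def iteC : Tm [] (T0 ⇒ T0 ⇒ T0 ⇒ T0) := lam (lam (lam (recr x2 x1 (lam (lam x2)))))
def ite0 {Γ : Ctx} (c a b : Tm Γ T0) : Tm Γ T0 := iteC.cl ⬝ c ⬝ a ⬝ b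

/-! Rational numbers are coded as `j(n, m) ↦ (n/2)/(m+1)` for even `n` and
`j(n, m) ↦ -((n+1)/2)/(m+1)` for odd `n`, with `j` Cantor's pairing function. -/

/-- Triangular numbers `w(w+1)/2`. -/
@[irreducible] def triC : Tm [] (T0 ⇒ T0) := lam (recr x0 zero (lam (lam (add x1 (succ x0)))))
def tri {Γ : Ctx} (a : Tm Γ T0) : Tm Γ T0 := triC.cl ⬝ a

/-- The largest `w` whose triangular number is at most `z`. -/
@[irreducible] def diagC : Tm [] (T0 ⇒ T0) :=
  lam (recr x0 zero (lam (lam (ite0 (tsub (tri (succ x1)) (succ x0)) (succ x1) x1))))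
def diag {Γ : Ctx} (a : Tm Γ T0) : Tm Γ T0 := diagC.cl ⬝ a

/-- First and second component of a coded pair `z = tri(n+m) + n`. -/
@[irreducible] def fstC : Tm [] (T0 ⇒ T0) := lam (tsub x0 (tri (diag x0)))
def fst {Γ : Ctx} (a : Tm Γ T0) : Tm Γ T0 := fstC.cl ⬝ a
@[irreducible] def sndC : Tm [] (T0 ⇒ T0) := lam (tsub (diag x0) (fst x0))
def snd {Γ : Ctx} (a : Tm Γ T0) : Tm Γ T0 := sndC.cl ⬝ a

/-- `0` if `n` is even, `1` if `n` is odd. -/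
@[irreducible] def parC : Tm [] (T0 ⇒ T0) := lam (recr x0 zero (lam (lam (tsub (succ zero) x1))))
def par {Γ : Ctx} (a : Tm Γ T0) : Tm Γ T0 := parC.cl ⬝ a

/-- `n / 2`, rounded down. -/
@[irreducible] def halfC : Tm [] (T0 ⇒ T0) := lam (recr x0 zero (lam (lam (add x1 (par x0)))))
def half {Γ : Ctx} (a : Tm Γ T0) : Tm Γ T0 := halfC.cl ⬝ a

/-- The rational with code `q` is `(qpos q - qneg q) / qden q`. -/
@[irreducible] def qposC : Tm [] (T0 ⇒ T0) := lam (ite0 (par (fst x0)) (half (fst x0)) zero)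
def qpos {Γ : Ctx} (q : Tm Γ T0) : Tm Γ T0 := qposC.cl ⬝ q
@[irreducible] def qnegC : Tm [] (T0 ⇒ T0) := lam (ite0 (par (fst x0)) zero (half (succ (fst x0))))
def qneg {Γ : Ctx} (q : Tm Γ T0) : Tm Γ T0 := qnegC.cl ⬝ q
@[irreducible] def qdenC : Tm [] (T0 ⇒ T0) := lam (succ (snd x0))
def qden {Γ : Ctx} (q : Tm Γ T0) : Tm Γ T0 := qdenC.cl ⬝ q

/-- The difference of the rationals `a`, `b` over the common denominator `qden a * qden b` is
`dPos a b - dNeg a b`. -/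
def dPos {Γ : Ctx} (a b : Tm Γ T0) : Tm Γ T0 :=
  add (mul (qpos a) (qden b)) (mul (qneg b) (qden a))
def dNeg {Γ : Ctx} (a b : Tm Γ T0) : Tm Γ T0 :=
  add (mul (qpos b) (qden a)) (mul (qneg a) (qden b))

/-- A term which is `0` exactly if the rationals `a`, `b` satisfy `|a - b| < 2^{-(k+1)}`. -/
@[irreducible] def farC : Tm [] (T0 ⇒ T0 ⇒ T0 ⇒ T0) :=
  lam (lam (lam (tsub (succ (mul (dist (dPos x2 x1) (dNeg x2 x1)) (pow2 (succ x0))))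
    (mul (qden x2) (qden x1)))))
def far {Γ : Ctx} (a b k : Tm Γ T0) : Tm Γ T0 := farC.cl ⬝ a ⬝ b ⬝ k

/-- The least `k < n` with `|f(k) - f(k+1)| ≥ 2^{-(k+1)}` if there is one, and `n` otherwise. -/
@[irreducible] def stopC : Tm [] (T1 ⇒ T0 ⇒ T0) :=
  lam (lam (recr x0 zero
    (lam (lam (ite0 (add (dist x1 x0) (far (x3 ⬝ x0) (x3 ⬝ succ x0) x0)) (succ x0) x1)))))

/-- The hat function: it turns every `f` of type `1` into a fast-converging Cauchy sequence of
rationals, and leaves such sequences unchanged. Every `f` of type `1` thus represents the real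
number `lim f̂(n)`. This is its `n`-th approximation `f̂(n)`. -/
def hat {Γ : Ctx} (f : Tm Γ T1) (n : Tm Γ T0) : Tm Γ T0 := f ⬝ (stopC.cl ⬝ f ⬝ n)

/-- Cantor's pairing function. -/
@[irreducible] def pairC : Tm [] (T0 ⇒ T0 ⇒ T0) := lam (lam (add (tri (add x1 x0)) x1))
/-- The real number one, with constant approximation the code `j(2, 0)` of the rational `1`. -/
@[irreducible] def realOneC : Tm [] T1 := lam (pairC.cl ⬝ succ (succ zero) ⬝ zero)

/-! ### Formulas -/

/-- Formulas of the language with the standardness predicates `st`. The only primitive equality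
is the one between numbers. -/
inductive Fm : Ctx → Type
  | eq0 {Γ : Ctx} : Tm Γ T0 → Tm Γ T0 → Fm Γ
  | st {Γ : Ctx} {σ : Ty} : Tm Γ σ → Fm Γ
  | bot {Γ : Ctx} : Fm Γ
  | imp {Γ : Ctx} : Fm Γ → Fm Γ → Fm Γ
  | and {Γ : Ctx} : Fm Γ → Fm Γ → Fm Γ
  | or {Γ : Ctx} : Fm Γ → Fm Γ → Fm Γ
  | all {Γ : Ctx} (σ : Ty) : Fm (σ :: Γ) → Fm Γ
  | ex {Γ : Ctx} (σ : Ty) : Fm (σ :: Γ) → Fm Γ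

def Fm.ren : {Γ Δ : Ctx} → Ren Γ Δ → Fm Γ → Fm Δ
  | _, _, r, Fm.eq0 t u => Fm.eq0 (t.ren r) (u.ren r)
  | _, _, r, Fm.st t => Fm.st (t.ren r)
  | _, _, _, Fm.bot => Fm.bot
  | _, _, r, Fm.imp φ ψ => Fm.imp (φ.ren r) (ψ.ren r)
  | _, _, r, Fm.and φ ψ => Fm.and (φ.ren r) (ψ.ren r)
  | _, _, r, Fm.or φ ψ => Fm.or (φ.ren r) (ψ.ren r)
  | _, _, r, Fm.all σ φ => Fm.all σ (φ.ren (r.lift σ))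
  | _, _, r, Fm.ex σ φ => Fm.ex σ (φ.ren (r.lift σ))

def Fm.sub : {Γ Δ : Ctx} → Sub Γ Δ → Fm Γ → Fm Δ
  | _, _, s, Fm.eq0 t u => Fm.eq0 (t.sub s) (u.sub s)
  | _, _, s, Fm.st t => Fm.st (t.sub s)
  | _, _, _, Fm.bot => Fm.bot
  | _, _, s, Fm.imp φ ψ => Fm.imp (φ.sub s) (ψ.sub s)
  | _, _, s, Fm.and φ ψ => Fm.and (φ.sub s) (ψ.sub s)
  | _, _, s, Fm.or φ ψ => Fm.or (φ.sub s) (ψ.sub s)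
  | _, _, s, Fm.all σ φ => Fm.all σ (φ.sub (s.lift σ))
  | _, _, s, Fm.ex σ φ => Fm.ex σ (φ.sub (s.lift σ))

abbrev Fm.wk {Γ : Ctx} (σ : Ty) (φ : Fm Γ) : Fm (σ :: Γ) := φ.ren (Ren.wk σ)

/-- `φ[t/x]` for the innermost variable `x`. -/
abbrev Fm.inst {Γ : Ctx} {σ : Ty} (φ : Fm (σ :: Γ)) (t : Tm Γ σ) : Fm Γ := φ.sub (Sub.one t)

/-- Internal formulas: those without `st`. -/
def Fm.Internal : {Γ : Ctx} → Fm Γ → Prop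
  | _, Fm.eq0 _ _ => True
  | _, Fm.st _ => False
  | _, Fm.bot => True
  | _, Fm.imp φ ψ => φ.Internal ∧ ψ.Internal
  | _, Fm.and φ ψ => φ.Internal ∧ ψ.Internal
  | _, Fm.or φ ψ => φ.Internal ∧ ψ.Internal
  | _, Fm.all _ φ => φ.Internal
  | _, Fm.ex _ φ => φ.Internal

/-- Quantifier-free internal formulas. -/
def Fm.QF : {Γ : Ctx} → Fm Γ → Prop
  | _, Fm.eq0 _ _ => True
  | _, Fm.st _ => False
  | _, Fm.bot => True
  | _, Fm.imp φ ψ => φ.QF ∧ ψ.QF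
  | _, Fm.and φ ψ => φ.QF ∧ ψ.QF
  | _, Fm.or φ ψ => φ.QF ∧ ψ.QF
  | _, Fm.all _ _ => False
  | _, Fm.ex _ _ => False

namespace Fm

def neg {Γ : Ctx} (φ : Fm Γ) : Fm Γ := imp φ bot
def iff {Γ : Ctx} (φ ψ : Fm Γ) : Fm Γ := and (imp φ ψ) (imp ψ φ)

/-- `a ≤ b`. -/
def le {Γ : Ctx} (a b : Tm Γ T0) : Fm Γ := eq0 (tsub a b) zero
/-- `a < b`. -/
def lt {Γ : Ctx} (a b : Tm Γ T0) : Fm Γ := le (succ a) b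

/-- Extensional equality at all types. -/
def eq : {Γ : Ctx} → (σ : Ty) → Tm Γ σ → Tm Γ σ → Fm Γ
  | _, Ty.nat, a, b => eq0 a b
  | _, Ty.arr σ τ, a, b => all σ (eq τ (a.wk σ ⬝ x0) (b.wk σ ⬝ x0))
  | _, Ty.seq σ, a, b =>
      and (eq0 (len a) (len b))
        (all T0 (imp (lt x0 (len (a.wk T0))) (eq σ (get (a.wk T0) x0) (get (b.wk T0) x0))))

/-- `(∀ˢᵗ x) φ`. -/
def allSt {Γ : Ctx} (σ : Ty) (φ : Fm (σ :: Γ)) : Fm Γ := all σ (imp (st x0) φ)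
/-- `(∃ˢᵗ x) φ`. -/
def exSt {Γ : Ctx} (σ : Ty) (φ : Fm (σ :: Γ)) : Fm Γ := ex σ (and (st x0) φ)

/-- `q ∈ Q`, i.e. `(∃ i < |Q|)(Q(i) = q)`. -/
def mem {Γ : Ctx} {σ : Ty} (q : Tm Γ σ) (Q : Tm Γ (Ty.seq σ)) : Fm Γ :=
  ex T0 (and (lt x0 (len (Q.wk T0))) (eq σ (get (Q.wk T0) x0) (q.wk T0)))

/-- `(∃ x ∈ Q) φ`. -/
def exIn {Γ : Ctx} {σ : Ty} (Q : Tm Γ (Ty.seq σ)) (φ : Fm (σ :: Γ)) : Fm Γ :=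
  ex σ (and (mem x0 (Q.wk σ)) φ)
/-- `(∀ x ∈ Q) φ`. -/
def allIn {Γ : Ctx} {σ : Ty} (Q : Tm Γ (Ty.seq σ)) (φ : Fm (σ :: Γ)) : Fm Γ :=
  all σ (imp (mem x0 (Q.wk σ)) φ)

end Fm

/-! ### Derivations -/

/-- A theory: a collection of axioms (in any context of free variables). -/
abbrev Theory : Type := ∀ Γ : Ctx, Fm Γ → Prop

/-- Derivations in classical many-sorted predicate logic (natural deduction) from the axioms of
`T` and the assumptions `Δ`. -/
inductive Deriv (T : Theory) : {Γ : Ctx} → List (Fm Γ) → Fm Γ → Type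
  | ax {Γ : Ctx} {Δ : List (Fm Γ)} {φ : Fm Γ} : T Γ φ → Deriv T Δ φ
  | hyp {Γ : Ctx} {Δ : List (Fm Γ)} {φ : Fm Γ} : φ ∈ Δ → Deriv T Δ φ
  | raa {Γ : Ctx} {Δ : List (Fm Γ)} {φ : Fm Γ} :
      Deriv T (φ.neg :: Δ) Fm.bot → Deriv T Δ φ
  | impI {Γ : Ctx} {Δ : List (Fm Γ)} {φ ψ : Fm Γ} :
      Deriv T (φ :: Δ) ψ → Deriv T Δ (Fm.imp φ ψ)
  | impE {Γ : Ctx} {Δ : List (Fm Γ)} {φ ψ : Fm Γ} :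
      Deriv T Δ (Fm.imp φ ψ) → Deriv T Δ φ → Deriv T Δ ψ
  | andI {Γ : Ctx} {Δ : List (Fm Γ)} {φ ψ : Fm Γ} :
      Deriv T Δ φ → Deriv T Δ ψ → Deriv T Δ (Fm.and φ ψ)
  | andE1 {Γ : Ctx} {Δ : List (Fm Γ)} {φ ψ : Fm Γ} : Deriv T Δ (Fm.and φ ψ) → Deriv T Δ φ
  | andE2 {Γ : Ctx} {Δ : List (Fm Γ)} {φ ψ : Fm Γ} : Deriv T Δ (Fm.and φ ψ) → Deriv T Δ ψ
  | orI1 {Γ : Ctx} {Δ : List (Fm Γ)} {φ ψ : Fm Γ} : Deriv T Δ φ → Deriv T Δ (Fm.or φ ψ)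
  | orI2 {Γ : Ctx} {Δ : List (Fm Γ)} {φ ψ : Fm Γ} : Deriv T Δ ψ → Deriv T Δ (Fm.or φ ψ)
  | orE {Γ : Ctx} {Δ : List (Fm Γ)} {φ ψ χ : Fm Γ} : Deriv T Δ (Fm.or φ ψ) →
      Deriv T (φ :: Δ) χ → Deriv T (ψ :: Δ) χ → Deriv T Δ χ
  | allI {Γ : Ctx} {Δ : List (Fm Γ)} {σ : Ty} {φ : Fm (σ :: Γ)} :
      Deriv T (Δ.map (Fm.wk σ)) φ → Deriv T Δ (Fm.all σ φ)
  | allE {Γ : Ctx} {Δ : List (Fm Γ)} {σ : Ty} {φ : Fm (σ :: Γ)} (t : Tm Γ σ) :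
      Deriv T Δ (Fm.all σ φ) → Deriv T Δ (φ.inst t)
  | exI {Γ : Ctx} {Δ : List (Fm Γ)} {σ : Ty} {φ : Fm (σ :: Γ)} (t : Tm Γ σ) :
      Deriv T Δ (φ.inst t) → Deriv T Δ (Fm.ex σ φ)
  | exE {Γ : Ctx} {Δ : List (Fm Γ)} {σ : Ty} {φ : Fm (σ :: Γ)} {χ : Fm Γ} :
      Deriv T Δ (Fm.ex σ φ) → Deriv T (φ :: Δ.map (Fm.wk σ)) (χ.wk σ) → Deriv T Δ χ

/-- Proofs of the sentence `φ` in `T`. -/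
abbrev Proof (T : Theory) (φ : Fm []) : Type := Deriv T [] φ

/-! ### The theories -/

open Fm in
/-- Axioms of `E-PRA^{ω*}`. The predicates `st` occur in none of them, so that in this theory `st`
is without any content: replacing `st(u)` by `0 = 0` throughout turns a derivation of an internal
formula into one in which all formulas are internal. -/
inductive EPRA : Theory
  -- equality of numbers is an equivalence relation
  | eqRefl {Γ : Ctx} (a : Tm Γ T0) : EPRA Γ (eq0 a a)
  | eqSymm {Γ : Ctx} (a b : Tm Γ T0) : EPRA Γ (imp (eq0 a b) (eq0 b a))
  | eqTrans {Γ : Ctx} (a b c : Tm Γ T0) :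
      EPRA Γ (imp (eq0 a b) (imp (eq0 b c) (eq0 a c)))
  -- the axiom of extensionality
  | ext {Γ : Ctx} {ρ τ : Ty} (f : Tm Γ (ρ ⇒ τ)) (a b : Tm Γ ρ) :
      EPRA Γ (imp (eq ρ a b) (eq τ (f ⬝ a) (f ⬝ b)))
  -- successor
  | succNe {Γ : Ctx} (a : Tm Γ T0) : EPRA Γ (neg (eq0 (succ a) zero))
  | succInj {Γ : Ctx} (a b : Tm Γ T0) : EPRA Γ (imp (eq0 (succ a) (succ b)) (eq0 a b))
  -- combinators and the recursor of type `0`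
  | combK {Γ : Ctx} {σ τ : Ty} (a : Tm Γ σ) (b : Tm Γ τ) :
      EPRA Γ (eq σ (Tm.con (Con.kk σ τ) ⬝ a ⬝ b) a)
  | combS {Γ : Ctx} {ρ σ τ : Ty} (a : Tm Γ (ρ ⇒ σ ⇒ τ)) (b : Tm Γ (ρ ⇒ σ)) (c : Tm Γ ρ) :
      EPRA Γ (eq τ (Tm.con (Con.ss ρ σ τ) ⬝ a ⬝ b ⬝ c) (a ⬝ c ⬝ (b ⬝ c)))
  | recZero {Γ : Ctx} (a : Tm Γ T0) (h : Tm Γ (T0 ⇒ T0 ⇒ T0)) :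
      EPRA Γ (eq0 (recr zero a h) a)
  | recSucc {Γ : Ctx} (n a : Tm Γ T0) (h : Tm Γ (T0 ⇒ T0 ⇒ T0)) :
      EPRA Γ (eq0 (recr (succ n) a h) (h ⬝ recr n a h ⬝ n))
  -- quantifier-free induction
  | ind {Γ : Ctx} (φ : Fm (T0 :: Γ)) : φ.QF →
      EPRA Γ (imp (φ.inst zero)
        (imp (all T0 (imp φ (((φ.ren ((Ren.wk T0).lift T0)).inst (succ x0)))))
          (all T0 φ)))
  -- finite sequences; equality of sequences is equality of length and components
  | lenMk {Γ : Ctx} {σ : Ty} (n : Tm Γ T0) (f : Tm Γ (T0 ⇒ σ)) :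
      EPRA Γ (eq0 (len (mkSeq n f)) n)
  | getMk {Γ : Ctx} {σ : Ty} (n i : Tm Γ T0) (f : Tm Γ (T0 ⇒ σ)) :
      EPRA Γ (imp (lt i n) (eq σ (get (mkSeq n f) i) (f ⬝ i)))
  | getMkOut {Γ : Ctx} {σ : Ty} (n i : Tm Γ T0) (f : Tm Γ (T0 ⇒ σ)) :
      EPRA Γ (imp (le n i) (eq σ (get (mkSeq n f) i) (zeroObj σ)))

open Fm in
/-- Axioms of `P₀`: those of `E-PRA^{ω*}`, the basic axioms for `st`, the Herbrandised axiom of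
choice, idealisation, and quantifier-free choice `QF-AC^{1,0}`. In the schemas the internal
formula `φ` may have parameters. -/
inductive P0 : Theory
  | epra {Γ : Ctx} {φ : Fm Γ} : EPRA Γ φ → P0 Γ φ
  | stEq {Γ : Ctx} {σ : Ty} (a b : Tm Γ σ) : P0 Γ (imp (and (st a) (eq σ a b)) (st b))
  | stClosed {Γ : Ctx} {σ : Ty} (t : Tm [] σ) : P0 Γ (st t.cl)
  | stApp {Γ : Ctx} {σ τ : Ty} (f : Tm Γ (σ ⇒ τ)) (a : Tm Γ σ) :
      P0 Γ (imp (and (st f) (st a)) (st (f ⬝ a)))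
  -- standard numbers are finite: every number below a standard number is standard
  -- (equivalently, the elements of a standard finite sequence are standard)
  | stBelow {Γ : Ctx} (n m : Tm Γ T0) : P0 Γ (imp (and (st m) (le n m)) (st n))
  -- `(∀ˢᵗ x)(∃ˢᵗ y) φ(x, y) → (∃ˢᵗ F)(∀ˢᵗ x)(∃ y ∈ F(x)) φ(x, y)`
  | hac {Γ : Ctx} {ρ τ : Ty} (φ : Fm (τ :: ρ :: Γ)) : φ.Internal →
      P0 Γ (imp (allSt ρ (exSt τ φ))
        (exSt (ρ ⇒ Ty.seq τ) (allSt ρ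
          (exIn (x1 ⬝ x0) (φ.ren (((Ren.wk (ρ ⇒ Ty.seq τ)).lift ρ).lift τ))))))
  -- `(∀ˢᵗ w)(∃ y)(∀ z ∈ w) φ(z, y) → (∃ y)(∀ˢᵗ z) φ(z, y)`
  | ideal {Γ : Ctx} {σ τ : Ty} (φ : Fm (σ :: τ :: Γ)) : φ.Internal →
      P0 Γ (imp
        (allSt (Ty.seq σ) (ex τ (allIn x1 (φ.ren (((Ren.wk (Ty.seq σ)).lift τ).lift σ)))))
        (ex τ (allSt σ φ)))
  -- `(∀ x)(∃ y) φ(x, y) → (∃ F)(∀ x) φ(x, F(x))`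
  | qfac {Γ : Ctx} (φ : Fm (T0 :: T1 :: Γ)) : φ.QF →
      P0 Γ (imp (all T1 (ex T0 φ))
        (ex T2 (all T1 ((φ.ren (((Ren.wk T2).lift T1).lift T0)).inst (x1 ⬝ x0)))))

/-! ### Real numbers and the statements concerned -/

namespace Fm

/-- `x ≤ y` for reals: `(∀ n)(x̂(n+1) - ŷ(n+1) < 2^{-n})`. -/
def realLe {Γ : Ctx} (x y : Tm Γ T1) : Fm Γ :=
  all T0
    (let a := hat (x.wk T0) (succ x0)
     let b := hat (y.wk T0) (succ x0)
     lt (mul (dPos a b) (pow2 x0)) (add (mul (dNeg a b) (pow2 x0)) (mul (qden a) (qden b))))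

/-- `|x - y| ≤ 1/k` for reals `x`, `y` and a positive number `k`:
`(∀ n)(|x̂(n+1) - ŷ(n+1)| < 1/k + 2^{-n})`, with denominators cleared.
For `k = 0` the formula is trivially true. -/
def realNear {Γ : Ctx} (x y : Tm Γ T1) (k : Tm Γ T0) : Fm Γ :=
  all T0
    (let a := hat (x.wk T0) (succ x0)
     let b := hat (y.wk T0) (succ x0)
     lt (mul (dist (dPos a b) (dNeg a b)) (mul (k.wk T0) (pow2 x0)))
       (mul (add (pow2 x0) (k.wk T0)) (mul (qden a) (qden b))))

/-- `x ≈ y` for reals: `(∀ˢᵗ k)(|x - y| ≤ 1/k)`. -/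
def realApprox {Γ : Ctx} (x y : Tm Γ T1) : Fm Γ :=
  allSt T0 (realNear (x.wk T0) (y.wk T0) x0)

/-- `(∀ n)(c_n ≤ c_{n+1} ≤ 1)`. -/
def incrBdd {Γ : Ctx} (c : Tm Γ TS) : Fm Γ :=
  all T0 (and (realLe (c.wk T0 ⬝ x0) (c.wk T0 ⬝ succ x0))
    (realLe (c.wk T0 ⬝ succ x0) realOneC.cl))

/-- `A(f, n)`: `(∃ m) f(m) = 0 → (∃ i ≤ n) f(i) = 0`. -/
def fmA {Γ : Ctx} (f : Tm Γ T1) (n : Tm Γ T0) : Fm Γ :=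
  imp (ex T0 (eq0 (f.wk T0 ⬝ x0) zero))
    (ex T0 (and (le x0 (n.wk T0)) (eq0 (f.wk T0 ⬝ x0) zero)))

/-- `B(c, k, m)`: `(∀ n)(c_n ≤ c_{n+1} ≤ 1) → (∀ N, M ≥ m) |c_M - c_N| ≤ 1/k`. -/
def fmB {Γ : Ctx} (c : Tm Γ TS) (k m : Tm Γ T0) : Fm Γ :=
  imp (incrBdd c)
    (all T0 (imp (le (m.wk T0) x0)
      (all T0 (imp (le ((m.wk T0).wk T0) x0)
        (realNear ((c.wk T0).wk T0 ⬝ x0) ((c.wk T0).wk T0 ⬝ x1) ((k.wk T0).wk T0))))))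

end Fm

open Fm

/-- `Π⁰₁-TRANS`: `(∀ˢᵗ f)[(∀ˢᵗ n) f(n) ≠ 0 → (∀ m) f(m) ≠ 0]`. -/
def TRANS : Fm [] :=
  allSt T1 (imp (allSt T0 (neg (eq0 (x1 ⬝ x0) zero))) (all T0 (neg (eq0 (x1 ⬝ x0) zero))))

/-- `MCT_ns`: `(∀ˢᵗ c)[(∀ n)(c_n ≤ c_{n+1} ≤ 1) → (∀ N, M ∈ Ω) c_M ≈ c_N]`,
where `N ∈ Ω` means that `N` is not standard. -/
def MCTns : Fm [] :=
  allSt TS (imp (incrBdd x0)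
    (all T0 (imp (neg (st x0)) (all T0 (imp (neg (st x0))
      (realApprox (x2 ⬝ x0) (x2 ⬝ x1)))))))

/-- `(∀ c, k, μ)(∃ m ∈ t₁(μ, c, k))(∃ f ∈ t₂(μ, c, k))[A(f, μ(f)) → B(c, k, m)]`. -/
def MTEfwd (t₁ : Tm [] (T2 ⇒ TS ⇒ T0 ⇒ Ty.seq T0)) (t₂ : Tm [] (T2 ⇒ TS ⇒ T0 ⇒ Ty.seq T1)) :
    Fm [] :=
  all TS (all T0 (all T2
    (exIn (t₁.cl ⬝ x0 ⬝ x2 ⬝ x1)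
      (exIn (t₂.cl ⬝ x1 ⬝ x3 ⬝ x2)
        (imp (fmA x0 (x2 ⬝ x0)) (fmB x4 x3 x1))))))

/-- `(∀ f, g)(∃ m ∈ s₁(f, g))(∃ c ∈ s₂(f, g))(∃ k ∈ s₃(f, g))[B(c, k, g(c)(k)) → A(f, m)]`. -/
def MTEbwd (s₁ : Tm [] (T1 ⇒ (TS ⇒ T1) ⇒ Ty.seq T0)) (s₂ : Tm [] (T1 ⇒ (TS ⇒ T1) ⇒ Ty.seq TS))
    (s₃ : Tm [] (T1 ⇒ (TS ⇒ T1) ⇒ Ty.seq T0)) : Fm [] :=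
  all T1 (all (TS ⇒ T1)
    (exIn (s₁.cl ⬝ x1 ⬝ x0)
      (exIn (s₂.cl ⬝ x2 ⬝ x1)
        (exIn (s₃.cl ⬝ x3 ⬝ x2)
          (imp (fmB x1 x0 (x3 ⬝ x1 ⬝ x0)) (fmA x4 x2))))))

/-- The Herbrandisation `MTE_her(s, t)`, for tuples `s`, `t` of closed terms. -/
def MTEher (s₁ : Tm [] (T1 ⇒ (TS ⇒ T1) ⇒ Ty.seq T0)) (s₂ : Tm [] (T1 ⇒ (TS ⇒ T1) ⇒ Ty.seq TS))
    (s₃ : Tm [] (T1 ⇒ (TS ⇒ T1) ⇒ Ty.seq T0))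
    (t₁ : Tm [] (T2 ⇒ TS ⇒ T0 ⇒ Ty.seq T0)) (t₂ : Tm [] (T2 ⇒ TS ⇒ T0 ⇒ Ty.seq T1)) : Fm [] :=
  Fm.and (MTEfwd t₁ t₂) (MTEbwd s₁ s₂ s₃)

end Herb

/-! Each principle is equivalent over $\textsf{P}_0$ to the existence of a standard functional, and
`MTEher` turns one kind of functional into the other by closed terms, which keep standard inputs
standard.

Transfer gives every standard $f$ a standard $n$ with $A(f,n)$: take a standard zero of $f$ if there
is one, and $0$ otherwise, since then $f$ has no zero at all. $\textsf{HAC}_{\textsf{int}}$ collects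
finitely many candidates $F(f)$ with $F$ standard. As $A$ is monotone in $n$, the sum of the
candidates works too, so there is a standard $\mu$ with $A(f,\mu(f))$ for all standard $f$
(`exists_st_functional_of_trans`). For standard $c,k$ the sequences $t_1(\mu,c,k)$, $t_2(\mu,c,k)$
are standard, hence so are their elements (`st_mem`). The forward half of `MTEher` yields $B(c,k,m)$
with $m$ standard, and nonstandard indices exceed $m$.

Conversely, assume monotone convergence and let $c,k$ be standard. If $B(c,k,m)$ failed for every
standard $m$, idealisation would give some $y$ above all standard numbers where it fails; but all
indices from $y$ on are nonstandard, so $B(c,k,y)$ holds. Choice over pairs $(c,k)$ and summation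
give a standard modulus $g$ (`exists_st_modulus_of_mct`). The backward half, applied to a standard
$f$ and $g$, yields $A(f,m)$ with $m$ standard: a zero of $f$ forces one below $m$, which is
standard.

Since derivations are formal objects, this rests on substitution lemmas, beta conversion for
combinatory abstraction, replacement of extensional equals (`replace`) and elementary arithmetic
from quantifier-free induction. -/

namespace Herb

/-! ### Renaming and substitution -/

section Substitution

variable {Γ Γ' Γ'' : Ctx} {σ τ ρ : Ty}

@[simp] theorem Ren.wk_apply (v : Var Γ τ) : Ren.wk σ τ v = Var.vs v := rfl
@[simp] theorem Ren.lift_vz (r : Ren Γ Γ') : r.lift σ σ Var.vz = Var.vz := rfl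
@[simp] theorem Ren.lift_vs (r : Ren Γ Γ') (v : Var Γ τ) :
    r.lift σ τ (Var.vs v) = Var.vs (r τ v) := rfl
@[simp] theorem Sub.lift_vz (s : Sub Γ Γ') : s.lift σ σ Var.vz = Tm.var Var.vz := rfl
@[simp] theorem Sub.lift_vs (s : Sub Γ Γ') (v : Var Γ τ) :
    s.lift σ τ (Var.vs v) = (s τ v).ren (Ren.wk σ) := rfl
@[simp] theorem Sub.one_vz (t : Tm Γ σ) : Sub.one t σ Var.vz = t := rfl
@[simp] theorem Sub.one_vs (t : Tm Γ σ) (v : Var Γ τ) : Sub.one t τ (Var.vs v) = Tm.var v := rfl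

@[simp] theorem Tm.ren_var (r : Ren Γ Γ') (v : Var Γ τ) : (Tm.var v).ren r = Tm.var (r τ v) := rfl
@[simp] theorem Tm.ren_con (r : Ren Γ Γ') (c : Con τ) : (Tm.con c).ren r = Tm.con c := rfl
@[simp] theorem Tm.ren_app (r : Ren Γ Γ') (t : Tm Γ (σ ⇒ τ)) (u : Tm Γ σ) :
    (t ⬝ u).ren r = t.ren r ⬝ u.ren r := rfl
@[simp] theorem Tm.sub_tvar (s : Sub Γ Γ') (v : Var Γ τ) : (Tm.var v).sub s = s τ v := rfl
@[simp] theorem Tm.sub_con (s : Sub Γ Γ') (c : Con τ) : (Tm.con c).sub s = Tm.con c := rfl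
@[simp] theorem Tm.sub_app (s : Sub Γ Γ') (t : Tm Γ (σ ⇒ τ)) (u : Tm Γ σ) :
    (t ⬝ u).sub s = t.sub s ⬝ u.sub s := rfl

theorem Tm.ren_ren (t : Tm Γ τ) (r : Ren Γ Γ') (r' : Ren Γ' Γ'') :
    (t.ren r).ren r' = t.ren fun _ v => r' _ (r _ v) := by
  induction t with
  | var v => rfl
  | con c => rfl
  | app t u iht ihu => simp [iht, ihu]

theorem Tm.ren_sub (t : Tm Γ τ) (r : Ren Γ Γ') (s : Sub Γ' Γ'') :
    (t.ren r).sub s = t.sub fun _ v => s _ (r _ v) := by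
  induction t with
  | var v => rfl
  | con c => rfl
  | app t u iht ihu => simp [iht, ihu]

theorem Tm.sub_ren (t : Tm Γ τ) (s : Sub Γ Γ') (r : Ren Γ' Γ'') :
    (t.sub s).ren r = t.sub fun _ v => (s _ v).ren r := by
  induction t with
  | var v => rfl
  | con c => rfl
  | app t u iht ihu => simp [iht, ihu]

theorem Tm.sub_id (t : Tm Γ τ) : (t.sub fun _ v => Tm.var v) = t := by
  induction t with
  | var v => rfl
  | con c => rfl
  | app t u iht ihu => simp [iht, ihu]

theorem Tm.ren_eq_sub (t : Tm Γ τ) (r : Ren Γ Γ') : t.ren r = t.sub fun _ v => Tm.var (r _ v) := by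
  induction t with
  | var v => rfl
  | con c => rfl
  | app t u iht ihu => simp [iht, ihu]

@[simp] theorem Tm.wk_sub_one (t : Tm Γ τ) (u : Tm Γ σ) : (t.ren (Ren.wk σ)).sub (Sub.one u) = t := by
  rw [Tm.ren_sub]; exact t.sub_id

@[simp] theorem Tm.wk_sub_lift (t : Tm Γ τ) (s : Sub Γ Γ') :
    (t.ren (Ren.wk σ)).sub (s.lift σ) = (t.sub s).ren (Ren.wk σ) := by
  rw [Tm.ren_sub, Tm.sub_ren]; rfl

@[simp] theorem Tm.wk_ren_lift (t : Tm Γ τ) (r : Ren Γ Γ') :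
    (t.ren (Ren.wk σ)).ren (r.lift σ) = (t.ren r).ren (Ren.wk σ) := by
  rw [Tm.ren_ren, Tm.ren_ren]; rfl

@[simp] theorem Tm.cl_ren (t : Tm [] τ) (r : Ren Γ Γ') :
    (t.ren Ren.empty).ren r = t.ren Ren.empty := by
  rw [Tm.ren_ren]; congr 1; funext _ v; nomatch v

@[simp] theorem Tm.cl_sub (t : Tm [] τ) (s : Sub Γ Γ') :
    (t.ren Ren.empty).sub s = t.ren Ren.empty := by
  rw [Tm.ren_sub, Tm.ren_eq_sub]; congr 1; funext _ v; nomatch v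

/-! ### Abstraction -/

theorem Tm.wk_str (t : Tm Γ τ) : (t.ren (Ren.wk σ)).str = some t := by
  induction t with
  | var v => rfl
  | con c => rfl
  | app t u iht ihu => simp [Tm.str, iht, ihu]

/-- A lifted substitution fixes the bound variable and puts weakened terms for all others, so it
neither creates nor destroys occurrences. The case distinction in `lam` is therefore stable. -/
theorem Tm.str_sub_lift (t : Tm (σ :: Γ) τ) (s : Sub Γ Γ') :
    (t.sub (s.lift σ)).str = t.str.map (Tm.sub s) := by
  induction t with
  | var v => cases v with
    | vz => rfl
    | vs v => simp [Tm.str, Tm.wk_str]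
  | con c => rfl
  | app t u iht ihu =>
    have h1 := iht
    have h2 := ihu
    simp only [Tm.sub_app, Tm.str] at h1 h2 ⊢
    rw [h1, h2]
    rcases t.str with _ | t' <;> rcases u.str with _ | u' <;> rfl

theorem Tm.eq_wk_of_str {t : Tm (σ :: Γ) τ} {w : Tm Γ τ} (h : t.str = some w) :
    t = w.ren (Ren.wk σ) := by
  induction t with
  | var v => cases v with
    | vz => simp [Tm.str] at h
    | vs v => simp only [Tm.str, Option.some.injEq] at h; subst h; rfl
  | con c => simp only [Tm.str, Option.some.injEq] at h; subst h; rfl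
  | app t u iht ihu =>
    simp only [Tm.str] at h
    split at h
    · rename_i t' u' ht hu
      simp only [Option.some.injEq] at h
      subst h
      rw [Tm.ren_app, ← iht ht, ← ihu hu]
    · simp at h

end Substitution

/-! ### Substitution in abstractions, terms and formulas. -/

section Commutation

variable {Γ Γ' : Ctx} {σ τ : Ty}

@[simp] theorem lam_sub (t : Tm (σ :: Γ) τ) (s : Sub Γ Γ') :
    (lam t).sub s = lam (t.sub (s.lift σ)) := by
  -- A free variable may be replaced by a compound term; its abstraction must still be the constant
  -- one, and the occurrence test in `lam` ensures this.
  have wk_lam : ∀ {τ : Ty} (w : Tm Γ' τ),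
      lam (w.ren (Ren.wk σ)) = Tm.con (Con.kk τ σ) ⬝ w := by
    intro τ w
    cases w with
    | var v => rfl
    | con c => rfl
    | app t u =>
      have h := (t ⬝ u).wk_str (σ := σ)
      simp only [Tm.ren_app] at h ⊢
      rw [lam, h]
  induction t with
  | var v => cases v with
    | vz => rfl
    | vs v => simp only [lam, Tm.sub_app, Tm.sub_con, Tm.sub_tvar, Sub.lift_vs, wk_lam]
  | con c => rfl
  | app t u iht ihu =>
    have h := (t ⬝ u).str_sub_lift s
    simp only [Tm.sub_app] at h ⊢
    rw [lam, lam, h]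
    rcases (t ⬝ u).str with _ | w
    · simp [iht, ihu]
    · rfl

theorem Ren.toSub_lift (r : Ren Γ Γ') :
    (fun τ v => Tm.var (r.lift σ τ v) : Sub (σ :: Γ) (σ :: Γ')) =
      Sub.lift (fun τ v => Tm.var (r τ v)) σ := by
  funext τ v
  cases v <;> rfl

@[simp] theorem lam_ren (t : Tm (σ :: Γ) τ) (r : Ren Γ Γ') :
    (lam t).ren r = lam (t.ren (r.lift σ)) := by
  rw [Tm.ren_eq_sub, Tm.ren_eq_sub, lam_sub, Ren.toSub_lift]

section Terms

variable (s : Sub Γ Γ') (r : Ren Γ Γ') (a b c : Tm Γ T0) (Q : Tm Γ (Ty.seq σ))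

@[simp] theorem zero_sub : zero.sub s = zero := rfl
@[simp] theorem zero_ren : zero.ren r = zero := rfl
@[simp] theorem succ_sub : (succ a).sub s = succ (a.sub s) := rfl
@[simp] theorem succ_ren : (succ a).ren r = succ (a.ren r) := rfl
@[simp] theorem recr_sub (h : Tm Γ (T0 ⇒ T0 ⇒ T0)) :
    (recr a b h).sub s = recr (a.sub s) (b.sub s) (h.sub s) := rfl
@[simp] theorem recr_ren (h : Tm Γ (T0 ⇒ T0 ⇒ T0)) :
    (recr a b h).ren r = recr (a.ren r) (b.ren r) (h.ren r) := rfl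
@[simp] theorem len_sub : (len Q).sub s = len (Q.sub s) := rfl
@[simp] theorem len_ren : (len Q).ren r = len (Q.ren r) := rfl
@[simp] theorem get_sub : (get Q a).sub s = get (Q.sub s) (a.sub s) := rfl
@[simp] theorem get_ren : (get Q a).ren r = get (Q.ren r) (a.ren r) := rfl
@[simp] theorem add_sub : (add a b).sub s = add (a.sub s) (b.sub s) := by simp [add]
@[simp] theorem add_ren : (add a b).ren r = add (a.ren r) (b.ren r) := by simp [add]
@[simp] theorem tsub_sub : (tsub a b).sub s = tsub (a.sub s) (b.sub s) := by simp [tsub]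
@[simp] theorem tsub_ren : (tsub a b).ren r = tsub (a.ren r) (b.ren r) := by simp [tsub]
@[simp] theorem pred_sub : (pred a).sub s = pred (a.sub s) := by simp [pred]
@[simp] theorem pred_ren : (pred a).ren r = pred (a.ren r) := by simp [pred]

end Terms

namespace Fm

section Connectives
variable (s : Sub Γ Γ') (r : Ren Γ Γ') (a b : Tm Γ T0) (φ ψ : Fm Γ) (χ : Fm (σ :: Γ))

@[simp] theorem eq0_sub : (eq0 a b).sub s = eq0 (a.sub s) (b.sub s) := rfl
@[simp] theorem eq0_ren : (eq0 a b).ren r = eq0 (a.ren r) (b.ren r) := rfl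
@[simp] theorem st_sub (t : Tm Γ τ) : (st t).sub s = st (t.sub s) := rfl
@[simp] theorem st_ren (t : Tm Γ τ) : (st t).ren r = st (t.ren r) := rfl
@[simp] theorem bot_sub : bot.sub s = bot := rfl
@[simp] theorem bot_ren : bot.ren r = bot := rfl
@[simp] theorem imp_sub : (imp φ ψ).sub s = imp (φ.sub s) (ψ.sub s) := rfl
@[simp] theorem imp_ren : (imp φ ψ).ren r = imp (φ.ren r) (ψ.ren r) := rfl
@[simp] theorem and_sub : (and φ ψ).sub s = and (φ.sub s) (ψ.sub s) := rfl
@[simp] theorem and_ren : (and φ ψ).ren r = and (φ.ren r) (ψ.ren r) := rfl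
@[simp] theorem or_sub : (or φ ψ).sub s = or (φ.sub s) (ψ.sub s) := rfl
@[simp] theorem or_ren : (or φ ψ).ren r = or (φ.ren r) (ψ.ren r) := rfl
@[simp] theorem all_sub : (all σ χ).sub s = all σ (χ.sub (s.lift σ)) := rfl
@[simp] theorem all_ren : (all σ χ).ren r = all σ (χ.ren (r.lift σ)) := rfl
@[simp] theorem ex_sub : (ex σ χ).sub s = ex σ (χ.sub (s.lift σ)) := rfl
@[simp] theorem ex_ren : (ex σ χ).ren r = ex σ (χ.ren (r.lift σ)) := rfl
@[simp] theorem neg_sub : (neg φ).sub s = neg (φ.sub s) := rfl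
@[simp] theorem neg_ren : (neg φ).ren r = neg (φ.ren r) := rfl
@[simp] theorem allSt_sub : (allSt σ χ).sub s = allSt σ (χ.sub (s.lift σ)) := rfl
@[simp] theorem allSt_ren : (allSt σ χ).ren r = allSt σ (χ.ren (r.lift σ)) := rfl
@[simp] theorem exSt_sub : (exSt σ χ).sub s = exSt σ (χ.sub (s.lift σ)) := rfl
@[simp] theorem exSt_ren : (exSt σ χ).ren r = exSt σ (χ.ren (r.lift σ)) := rfl
@[simp] theorem le_sub : (le a b).sub s = le (a.sub s) (b.sub s) := by simp [le]
@[simp] theorem le_ren : (le a b).ren r = le (a.ren r) (b.ren r) := by simp [le]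
@[simp] theorem lt_sub : (lt a b).sub s = lt (a.sub s) (b.sub s) := by simp [lt]
@[simp] theorem lt_ren : (lt a b).ren r = lt (a.ren r) (b.ren r) := by simp [lt]

end Connectives

@[simp] theorem eq_sub (s : Sub Γ Γ') (t u : Tm Γ τ) :
    (eq τ t u).sub s = eq τ (t.sub s) (u.sub s) := by
  induction τ generalizing Γ Γ' with
  | nat => rfl
  | arr σ τ _ ih => simp [eq, ih]
  | seq σ ih => simp [eq, ih]

@[simp] theorem eq_ren (r : Ren Γ Γ') (t u : Tm Γ τ) :
    (eq τ t u).ren r = eq τ (t.ren r) (u.ren r) := by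
  induction τ generalizing Γ Γ' with
  | nat => rfl
  | arr σ τ _ ih => simp [eq, ih]
  | seq σ ih => simp [eq, ih]

section Predicates
variable (s : Sub Γ Γ') (r : Ren Γ Γ') (q : Tm Γ σ) (Q : Tm Γ (Ty.seq σ)) (χ : Fm (σ :: Γ))
  (f g : Tm Γ T1) (c : Tm Γ TS) (k m : Tm Γ T0)

@[simp] theorem mem_sub : (mem q Q).sub s = mem (q.sub s) (Q.sub s) := by simp [mem]
@[simp] theorem mem_ren : (mem q Q).ren r = mem (q.ren r) (Q.ren r) := by simp [mem]
@[simp] theorem exIn_sub : (exIn Q χ).sub s = exIn (Q.sub s) (χ.sub (s.lift σ)) := by simp [exIn]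
@[simp] theorem exIn_ren : (exIn Q χ).ren r = exIn (Q.ren r) (χ.ren (r.lift σ)) := by simp [exIn]
@[simp] theorem allIn_sub : (allIn Q χ).sub s = allIn (Q.sub s) (χ.sub (s.lift σ)) := by
  simp [allIn]

@[simp] theorem realLe_sub : (realLe f g).sub s = realLe (f.sub s) (g.sub s) := by
  simp [realLe, hat, dPos, dNeg, mul, qpos, qneg, qden, pow2]
@[simp] theorem realLe_ren : (realLe f g).ren r = realLe (f.ren r) (g.ren r) := by
  simp [realLe, hat, dPos, dNeg, mul, qpos, qneg, qden, pow2]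
@[simp] theorem realNear_sub :
    (realNear f g k).sub s = realNear (f.sub s) (g.sub s) (k.sub s) := by
  simp [realNear, hat, dPos, dNeg, mul, qpos, qneg, qden, pow2, dist]
@[simp] theorem realNear_ren :
    (realNear f g k).ren r = realNear (f.ren r) (g.ren r) (k.ren r) := by
  simp [realNear, hat, dPos, dNeg, mul, qpos, qneg, qden, pow2, dist]
@[simp] theorem realApprox_sub : (realApprox f g).sub s = realApprox (f.sub s) (g.sub s) := by
  simp [realApprox]
@[simp] theorem realApprox_ren : (realApprox f g).ren r = realApprox (f.ren r) (g.ren r) := by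
  simp [realApprox]
@[simp] theorem incrBdd_sub : (incrBdd c).sub s = incrBdd (c.sub s) := by simp [incrBdd]
@[simp] theorem incrBdd_ren : (incrBdd c).ren r = incrBdd (c.ren r) := by simp [incrBdd]
@[simp] theorem fmA_sub : (fmA f m).sub s = fmA (f.sub s) (m.sub s) := by simp [fmA]
@[simp] theorem fmA_ren : (fmA f m).ren r = fmA (f.ren r) (m.ren r) := by simp [fmA]
@[simp] theorem fmB_sub : (fmB c k m).sub s = fmB (c.sub s) (k.sub s) (m.sub s) := by simp [fmB]
@[simp] theorem fmB_ren : (fmB c k m).ren r = fmB (c.ren r) (k.ren r) (m.ren r) := by simp [fmB]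

end Predicates

end Fm
end Commutation

/-! ### Provability in `P₀` -/

open Fm

/-- `φ` is derivable in `P₀` from the assumptions `Δ`. -/
def Pr {Γ : Ctx} (Δ : List (Fm Γ)) (φ : Fm Γ) : Prop := Nonempty (Deriv P0 Δ φ)

namespace Pr

section Logic

variable {Γ : Ctx} {Δ Δ' : List (Fm Γ)} {φ ψ χ a b c d e f g i : Fm Γ} {σ τ : Ty} {θ : Fm (σ :: Γ)}

theorem ax (h : P0 Γ φ) : Pr Δ φ := ⟨.ax h⟩
theorem epra (h : EPRA Γ φ) : Pr Δ φ := ⟨.ax (.epra h)⟩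
theorem hyp (h : φ ∈ Δ) : Pr Δ φ := ⟨.hyp h⟩
theorem weaken (h : Pr Δ φ) (hs : Δ ⊆ Δ') : Pr Δ' φ := h.elim fun d => by
  induction d with
  | ax ha => exact ⟨.ax ha⟩
  | hyp hm => exact ⟨.hyp (hs hm)⟩
  | raa d ih => exact (ih ⟨d⟩ (List.cons_subset_cons _ hs)).elim fun d => ⟨.raa d⟩
  | impI d ih => exact (ih ⟨d⟩ (List.cons_subset_cons _ hs)).elim fun d => ⟨.impI d⟩
  | impE d d' ih ih' => exact (ih ⟨d⟩ hs).elim fun d => (ih' ⟨d'⟩ hs).elim fun d' => ⟨.impE d d'⟩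
  | andI d d' ih ih' => exact (ih ⟨d⟩ hs).elim fun d => (ih' ⟨d'⟩ hs).elim fun d' => ⟨.andI d d'⟩
  | andE1 d ih => exact (ih ⟨d⟩ hs).elim fun d => ⟨.andE1 d⟩
  | andE2 d ih => exact (ih ⟨d⟩ hs).elim fun d => ⟨.andE2 d⟩
  | orI1 d ih => exact (ih ⟨d⟩ hs).elim fun d => ⟨.orI1 d⟩
  | orI2 d ih => exact (ih ⟨d⟩ hs).elim fun d => ⟨.orI2 d⟩
  | orE d d1 d2 ih ih1 ih2 =>
    exact (ih ⟨d⟩ hs).elim fun d => (ih1 ⟨d1⟩ (List.cons_subset_cons _ hs)).elim fun d1 =>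
      (ih2 ⟨d2⟩ (List.cons_subset_cons _ hs)).elim fun d2 => ⟨.orE d d1 d2⟩
  | allI d ih => exact (ih ⟨d⟩ (List.map_subset _ hs)).elim fun d => ⟨.allI d⟩
  | allE t d ih => exact (ih ⟨d⟩ hs).elim fun d => ⟨.allE t d⟩
  | exI t d ih => exact (ih ⟨d⟩ hs).elim fun d => ⟨.exI t d⟩
  | exE d d' ih ih' =>
    exact (ih ⟨d⟩ hs).elim fun d =>
      (ih' ⟨d'⟩ (List.cons_subset_cons _ (List.map_subset _ hs))).elim fun d' => ⟨.exE d d'⟩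
theorem w (h : Pr Δ φ) : Pr (ψ :: Δ) φ := h.weaken (List.subset_cons_self _ _)
theorem cast (h : Pr Δ φ) (hφ : φ = ψ := by simp) : Pr Δ ψ := hφ ▸ h
theorem raa (h : Pr (φ.neg :: Δ) bot) : Pr Δ φ := h.elim fun d => ⟨.raa d⟩
theorem impI (h : Pr (φ :: Δ) ψ) : Pr Δ (imp φ ψ) := h.elim fun d => ⟨.impI d⟩
theorem mp (h : Pr Δ (imp φ ψ)) (h' : Pr Δ φ) : Pr Δ ψ :=
  h.elim fun d => h'.elim fun d' => ⟨.impE d d'⟩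
theorem negE (h : Pr Δ (neg φ)) (h' : Pr Δ φ) : Pr Δ bot := mp h h'
theorem cut (h : Pr Δ φ) (h' : Pr (φ :: Δ) ψ) : Pr Δ ψ := h'.impI.mp h
theorem andI (h : Pr Δ φ) (h' : Pr Δ ψ) : Pr Δ (and φ ψ) :=
  h.elim fun d => h'.elim fun d' => ⟨.andI d d'⟩
theorem andL (h : Pr Δ (and φ ψ)) : Pr Δ φ := h.elim fun d => ⟨.andE1 d⟩
theorem andR (h : Pr Δ (and φ ψ)) : Pr Δ ψ := h.elim fun d => ⟨.andE2 d⟩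
theorem orL (h : Pr Δ φ) : Pr Δ (or φ ψ) := h.elim fun d => ⟨.orI1 d⟩
theorem orR (h : Pr Δ ψ) : Pr Δ (or φ ψ) := h.elim fun d => ⟨.orI2 d⟩
theorem orE (h : Pr Δ (or φ ψ)) (h1 : Pr (φ :: Δ) χ) (h2 : Pr (ψ :: Δ) χ) : Pr Δ χ :=
  h.elim fun d => h1.elim fun d1 => h2.elim fun d2 => ⟨.orE d d1 d2⟩
theorem allI (h : Pr (Δ.map (Fm.ren (Ren.wk σ))) θ) : Pr Δ (all σ θ) := h.elim fun d => ⟨.allI d⟩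
theorem allE (h : Pr Δ (all σ θ)) (t : Tm Γ σ) : Pr Δ (θ.sub (Sub.one t)) :=
  h.elim fun d => ⟨.allE t d⟩
theorem allE2 {θ : Fm (τ :: σ :: Γ)} (h : Pr Δ (all σ (all τ θ))) (t : Tm Γ σ) (u : Tm Γ τ)
    (hψ : (θ.sub ((Sub.one t).lift τ)).sub (Sub.one u) = ψ := by simp) : Pr Δ ψ :=
  hψ ▸ allE (allE h t) u
theorem allE3 {ρ : Ty} {θ : Fm (ρ :: τ :: σ :: Γ)} (h : Pr Δ (all σ (all τ (all ρ θ))))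
    (t : Tm Γ σ) (u : Tm Γ τ) (v : Tm Γ ρ)
    (hψ : ((θ.sub (((Sub.one t).lift τ).lift ρ)).sub ((Sub.one u).lift ρ)).sub (Sub.one v) = ψ :=
      by simp) : Pr Δ ψ :=
  hψ ▸ allE (allE (allE h t) u) v
theorem exI (t : Tm Γ σ) (h : Pr Δ (θ.sub (Sub.one t))) : Pr Δ (ex σ θ) :=
  h.elim fun d => ⟨.exI t d⟩
theorem exE (h : Pr Δ (ex σ θ))
    (h' : Pr (θ :: Δ.map (Fm.ren (Ren.wk σ))) (χ.ren (Ren.wk σ))) : Pr Δ χ :=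
  h.elim fun d => h'.elim fun d' => ⟨.exE d d'⟩
theorem efq (h : Pr Δ bot) : Pr Δ φ := raa h.w
theorem em (φ : Fm Γ) : Pr Δ (or φ φ.neg) := by
  apply raa
  refine negE (hyp (List.mem_cons_self)) (orR (impI ?_))
  exact negE (hyp (List.mem_cons_of_mem _ List.mem_cons_self)) (orL (hyp List.mem_cons_self))
theorem cases (φ : Fm Γ) (h1 : Pr (φ :: Δ) χ) (h2 : Pr (φ.neg :: Δ) χ) : Pr Δ χ :=
  orE (em φ) h1 h2

theorem h0 : Pr (a :: Δ) a := hyp List.mem_cons_self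
theorem h1 : Pr (b :: a :: Δ) a := h0.w
theorem h2 : Pr (c :: b :: a :: Δ) a := h1.w
theorem h3 : Pr (d :: c :: b :: a :: Δ) a := h2.w
theorem h4 : Pr (e :: d :: c :: b :: a :: Δ) a := h3.w
theorem h5 : Pr (f :: e :: d :: c :: b :: a :: Δ) a := h4.w
theorem h6 : Pr (g :: f :: e :: d :: c :: b :: a :: Δ) a := h5.w

/-- Derivations in `E-PRA^{ω*}` are derivations in `P₀`. -/
theorem of_epra (d : Deriv EPRA Δ φ) : Pr Δ φ := by
  induction d with
  | ax h => exact epra h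
  | hyp h => exact hyp h
  | raa _ ih => exact raa ih
  | impI _ ih => exact impI ih
  | impE _ _ ih ih' => exact mp ih ih'
  | andI _ _ ih ih' => exact andI ih ih'
  | andE1 _ ih => exact andL ih
  | andE2 _ ih => exact andR ih
  | orI1 _ ih => exact orL ih
  | orI2 _ ih => exact orR ih
  | orE _ _ _ ih ih1 ih2 => exact orE ih ih1 ih2
  | allI _ ih => exact allI ih
  | allE t _ ih => exact allE ih t
  | exI t _ ih => exact exI t ih
  | exE _ _ ih ih' => exact exE ih ih'

end Logic

/-! ### Extensional equality and beta conversion. -/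

section Equality

variable {Γ : Ctx} {Δ : List (Fm Γ)} {σ τ : Ty}

theorem eq0_trans {a b c : Tm Γ T0} (h : Pr Δ (eq0 a b)) (h' : Pr Δ (eq0 b c)) :
    Pr Δ (eq0 a c) := ((epra (.eqTrans a b c)).mp h).mp h'
theorem eq0_symm {a b : Tm Γ T0} (h : Pr Δ (eq0 a b)) : Pr Δ (eq0 b a) :=
  (epra (.eqSymm a b)).mp h
theorem ext {a b : Tm Γ σ} (f : Tm Γ (σ ⇒ τ)) (h : Pr Δ (eq σ a b)) :
    Pr Δ (eq τ (f ⬝ a) (f ⬝ b)) := (epra (.ext f a b)).mp h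

theorem eq_app {f g : Tm Γ (σ ⇒ τ)} (h : Pr Δ (eq (σ ⇒ τ) f g)) (a : Tm Γ σ) :
    Pr Δ (eq τ (f ⬝ a) (g ⬝ a)) := (h.allE a).cast

theorem lt_of_eq0 {i a b : Tm Γ T0} (h : Pr Δ (lt i a)) (e : Pr Δ (eq0 a b)) : Pr Δ (lt i b) :=
  eq0_trans (ext (σ := T0) (τ := T0) (subC.cl ⬝ succ i) (eq0_symm e)) h

theorem eq_refl (t : Tm Γ τ) : Pr Δ (eq τ t t) := by
  induction τ generalizing Γ with
  | nat => exact epra (.eqRefl t)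
  | arr σ τ _ ih => exact allI (ih _)
  | seq σ ih => exact andI (epra (.eqRefl _)) (allI (impI (ih _)))

theorem eq_symm {t u : Tm Γ τ} (h : Pr Δ (eq τ t u)) : Pr Δ (eq τ u t) := by
  induction τ generalizing Γ with
  | nat => exact eq0_symm h
  | arr σ τ _ ih => exact cut h (allI (ih ((h0.allE x0).cast)))
  | seq σ ih =>
    refine cut h (andI (eq0_symm h0.andL) (allI (impI (ih ?_))))
    -- The index bound refers to the length of the other sequence and is moved across the equality
    -- of lengths.
    exact ((h1.andR.allE x0).mp (lt_of_eq0 (a := len (u.wk T0)) h0 (eq0_symm h1.andL)).cast).cast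

theorem eq_trans {t u v : Tm Γ τ} (h : Pr Δ (eq τ t u)) (h' : Pr Δ (eq τ u v)) :
    Pr Δ (eq τ t v) := by
  induction τ generalizing Γ with
  | nat => exact eq0_trans h h'
  | arr σ τ _ ih => exact cut h (cut h'.w (allI (ih (u := u.wk σ ⬝ x0) (h1.allE x0).cast (h0.allE x0).cast)))
  | seq σ ih =>
    refine cut h (cut h'.w (andI (eq0_trans h1.andL h0.andL) (allI (impI (ih (u := get (u.wk T0) x0)
      ?_ ?_)))))
    · exact ((h2.andR.allE x0).mp h0.cast).cast
    · exact ((h1.andR.allE x0).mp (lt_of_eq0 (a := len (t.wk T0)) h0 h2.andL).cast).cast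

theorem congr {f g : Tm Γ (σ ⇒ τ)} {a b : Tm Γ σ} (h : Pr Δ (eq (σ ⇒ τ) f g))
    (h' : Pr Δ (eq σ a b)) : Pr Δ (eq τ (f ⬝ a) (g ⬝ b)) :=
  eq_trans (eq_app h a) (ext g h')

/-- The induction follows the clauses of `lam`: the axiom for `Σ` distributes the argument, and the
axiom for `Π` discards it when the variable does not occur. -/
theorem beta (t : Tm (σ :: Γ) τ) (u : Tm Γ σ) : Pr Δ (eq τ (lam t ⬝ u) (t.sub (Sub.one u))) := by
  induction t with
  | var v => cases v with
    | vz => exact eq_trans (epra (.combS _ _ _)) (epra (.combK _ _))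
    | vs v => exact epra (.combK _ _)
  | con c => exact epra (.combK _ _)
  | app t v iht ihv =>
    rw [lam]
    rcases h : (t ⬝ v).str with _ | w
    · exact eq_trans (epra (.combS _ _ _)) (congr iht ihv)
    · rw [Tm.eq_wk_of_str h, Tm.wk_sub_one]
      exact epra (.combK _ _)

/-- The first argument is substituted below the remaining abstraction, which is where `lam_sub` is
needed. -/
theorem beta2 {ρ : Ty} (t : Tm (σ :: ρ :: Γ) τ) (u : Tm Γ ρ) (v : Tm Γ σ) :
    Pr Δ (eq τ (lam (lam t) ⬝ u ⬝ v) ((t.sub ((Sub.one u).lift σ)).sub (Sub.one v))) := by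
  have h : Pr Δ (eq _ (lam (lam t) ⬝ u) _) := beta (lam t) u
  rw [lam_sub] at h
  exact eq_trans (eq_app h v) (beta _ v)

end Equality

end Pr

theorem Fm.ren_sub {Γ Γ' Γ'' : Ctx} (φ : Fm Γ) (r : Ren Γ Γ') (s : Sub Γ' Γ'') :
    (φ.ren r).sub s = φ.sub fun _ v => s _ (r _ v) := by
  induction φ generalizing Γ' Γ'' with
  | eq0 t u => simp [Tm.ren_sub]
  | st t => simp [Tm.ren_sub]
  | bot => rfl
  | imp φ ψ ih ih' => simp [ih, ih']
  | and φ ψ ih ih' => simp [ih, ih']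
  | or φ ψ ih ih' => simp [ih, ih']
  | all σ φ ih =>
    simp only [all_ren, all_sub, ih]
    congr 2
    funext τ v
    cases v <;> rfl
  | ex σ φ ih =>
    simp only [ex_ren, ex_sub, ih]
    congr 2
    funext τ v
    cases v <;> rfl

theorem Fm.sub_id {Γ : Ctx} (φ : Fm Γ) : (φ.sub fun _ v => Tm.var v) = φ := by
  have hl : ∀ {Γ : Ctx} (σ : Ty), Sub.lift (fun τ v => Tm.var v : Sub Γ Γ) σ =
      fun τ v => Tm.var v := by
    intro Γ σ
    funext τ v
    cases v <;> rfl
  induction φ with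
  | eq0 t u => simp [Tm.sub_id]
  | st t => simp [Tm.sub_id]
  | bot => rfl
  | imp φ ψ ih ih' => simp [ih, ih']
  | and φ ψ ih ih' => simp [ih, ih']
  | or φ ψ ih ih' => simp [ih, ih']
  | all σ φ ih => simp [hl, ih]
  | ex σ φ ih => simp [hl, ih]

/-- This is the shape produced when a weakened quantifier is opened with its own bound variable. -/
theorem Fm.ren_lift_sub_one {Γ : Ctx} {σ : Ty} (φ : Fm (σ :: Γ)) :
    (φ.ren ((Ren.wk σ).lift σ)).sub (Sub.one x0) = φ := by
  rw [Fm.ren_sub]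
  refine Eq.trans (congrArg (fun s => Fm.sub s φ) ?_) φ.sub_id
  funext τ v
  cases v <;> rfl

namespace Pr

/-! ### Replacement of extensional equals. -/

section Replacement

variable {Γ Γ' : Ctx} {τ : Ty}

/-- The hypothesis is a disjunction so that it passes under quantifiers: a newly bound variable
falls under the first alternative, and assumed equalities are weakened together with the other
assumptions. -/
theorem replace_tm (t : Tm Γ τ) {s s' : Sub Γ Γ'} {Δ : List (Fm Γ')}
    (h : ∀ τ v, s τ v = s' τ v ∨ eq τ (s τ v) (s' τ v) ∈ Δ) :
    Pr Δ (eq τ (t.sub s) (t.sub s')) := by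
  induction t with
  | var v =>
    rcases h _ v with h | h
    · simp only [Tm.sub_tvar, h]; exact eq_refl _
    · exact hyp h
  | con c => exact eq_refl _
  | app t u iht ihu => exact congr iht ihu

/-- Extensionally equal objects have the same properties. -/
theorem replace (φ : Fm Γ) {s s' : Sub Γ Γ'} {Δ : List (Fm Γ')}
    (h : ∀ τ v, s τ v = s' τ v ∨ eq τ (s τ v) (s' τ v) ∈ Δ) :
    Pr Δ (imp (φ.sub s) (φ.sub s')) ∧ Pr Δ (imp (φ.sub s') (φ.sub s)) := by
  have hw : ∀ {Γ Γ' : Ctx} {s s' : Sub Γ Γ'} {Δ : List (Fm Γ')} (ψ : Fm Γ'),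
      (∀ τ v, s τ v = s' τ v ∨ eq τ (s τ v) (s' τ v) ∈ Δ) →
      ∀ τ v, s τ v = s' τ v ∨ eq τ (s τ v) (s' τ v) ∈ ψ :: Δ :=
    fun _ h τ v => (h τ v).imp id (List.mem_cons_of_mem _)
  have hl : ∀ {Γ Γ' : Ctx} {s s' : Sub Γ Γ'} {Δ : List (Fm Γ')} (σ : Ty),
      (∀ τ v, s τ v = s' τ v ∨ eq τ (s τ v) (s' τ v) ∈ Δ) →
      ∀ τ v, s.lift σ τ v = s'.lift σ τ v ∨
        eq τ (s.lift σ τ v) (s'.lift σ τ v) ∈ Δ.map (Fm.ren (Ren.wk σ)) := by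
    intro Γ Γ' s s' Δ σ h τ v
    cases v with
    | vz => exact .inl rfl
    | vs v =>
      refine (h _ v).imp (fun h => by simp [h]) fun h => ?_
      exact List.mem_map.2 ⟨_, h, by simp⟩
  have hq : ∀ {Γ : Ctx} {σ : Ty} (φ : Fm (σ :: Γ)),
      (φ.ren ((Ren.wk σ).lift σ)).sub (Sub.one x0) = φ :=
    fun φ => φ.ren_lift_sub_one
  induction φ generalizing Γ' with
  | eq0 a b =>
    have ha := replace_tm a h
    have hb := replace_tm b h
    exact ⟨impI (eq0_trans (eq0_symm ha.w) (eq0_trans h0 hb.w)),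
      impI (eq0_trans ha.w (eq0_trans h0 (eq0_symm hb.w)))⟩
  | st t =>
    have ht := replace_tm t h
    exact ⟨impI ((ax (.stEq _ _)).mp (h0.andI ht.w)),
      impI ((ax (.stEq _ _)).mp (h0.andI (eq_symm ht.w)))⟩
  | bot => exact ⟨impI h0, impI h0⟩
  -- The premise needs the opposite direction, which is why both are proved simultaneously.
  | imp φ ψ ih ih' =>
    exact ⟨impI (impI ((ih' h).1.w.w.mp (h1.mp ((ih h).2.w.w.mp h0)))),
      impI (impI ((ih' h).2.w.w.mp (h1.mp ((ih h).1.w.w.mp h0))))⟩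
  | and φ ψ ih ih' =>
    exact ⟨impI (((ih h).1.w.mp h0.andL).andI ((ih' h).1.w.mp h0.andR)),
      impI (((ih h).2.w.mp h0.andL).andI ((ih' h).2.w.mp h0.andR))⟩
  | or φ ψ ih ih' =>
    exact ⟨impI (h0.orE ((ih h).1.w.w.mp h0).orL ((ih' h).1.w.w.mp h0).orR),
      impI (h0.orE ((ih h).2.w.w.mp h0).orL ((ih' h).2.w.w.mp h0).orR)⟩
  | all σ φ ih =>
    exact ⟨impI (allI ((ih (hl σ h)).1.w.mp ((h0.allE x0).cast (hq _)))),
      impI (allI ((ih (hl σ h)).2.w.mp ((h0.allE x0).cast (hq _))))⟩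
  | ex σ φ ih =>
    exact ⟨impI (h0.exE (exI x0 (((ih (hl σ h)).1.w.w.mp h0).cast (hq _).symm))),
      impI (h0.exE (exI x0 (((ih (hl σ h)).2.w.w.mp h0).cast (hq _).symm)))⟩

end Replacement

/-! ### Arithmetic and order from quantifier-free induction. -/

section Arithmetic

variable {Γ : Ctx} {Δ : List (Fm Γ)} {a b c d : Tm Γ T0}

theorem ind (φ : Fm (T0 :: Γ)) (hφ : φ.QF) (h : Pr Δ (φ.sub (Sub.one zero)))
    (hs : Pr (φ :: Δ.map (Fm.ren (Ren.wk T0)))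
      ((φ.ren ((Ren.wk T0).lift T0)).sub (Sub.one (succ x0)))) (a : Tm Γ T0) :
    Pr Δ (φ.sub (Sub.one a)) :=
  (((epra (.ind φ hφ)).mp h).mp (allI hs.impI)).allE a

theorem refl (a : Tm Γ T0) : Pr Δ (eq0 a a) := epra (.eqRefl a)
theorem succ_congr (h : Pr Δ (eq0 a b)) : Pr Δ (eq0 (succ a) (succ b)) :=
  ext (σ := T0) (τ := T0) (Tm.con Con.succ) h
theorem pred_congr (h : Pr Δ (eq0 a b)) : Pr Δ (eq0 (pred a) (pred b)) :=
  ext (σ := T0) (τ := T0) predC.cl h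
theorem tsub_congr (h : Pr Δ (eq0 a b)) (h' : Pr Δ (eq0 c d)) :
    Pr Δ (eq0 (tsub a c) (tsub b d)) :=
  congr (σ := T0) (τ := T0) (ext (σ := T0) (τ := T0 ⇒ T0) subC.cl h) h'
theorem add_congr (h : Pr Δ (eq0 a b)) (h' : Pr Δ (eq0 c d)) :
    Pr Δ (eq0 (add a c) (add b d)) :=
  congr (σ := T0) (τ := T0) (ext (σ := T0) (τ := T0 ⇒ T0) addC.cl h) h'
theorem le_congr (h : Pr Δ (eq0 a b)) (h' : Pr Δ (eq0 c d)) (hl : Pr Δ (le a c)) :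
    Pr Δ (le b d) := eq0_trans (eq0_symm (tsub_congr h h')) hl

theorem recr_lam_succ (t : Tm (T0 :: T0 :: Γ) T0) :
    Pr Δ (eq0 (recr (succ b) a (lam (lam t)))
      ((t.sub ((Sub.one (recr b a (lam (lam t)))).lift T0)).sub (Sub.one b))) :=
  eq0_trans (epra (.recSucc _ _ _)) (beta2 (τ := T0) t _ _)

theorem pred_eq : Pr Δ (eq0 (pred a) (recr a zero (lam (lam x0)))) := by
  simpa [pred, predC, eq] using beta (Δ := Δ) (recr x0 zero (lam (lam x0))) a
theorem pred_zero : Pr Δ (eq0 (pred zero) zero) := eq0_trans pred_eq (epra (.recZero _ _))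
theorem pred_succ : Pr Δ (eq0 (pred (succ a)) a) :=
  eq0_trans pred_eq ((recr_lam_succ (b := a) (a := zero) x0).cast)

theorem add_eq : Pr Δ (eq0 (add a b) (recr b a (lam (lam (succ x1))))) := by
  simpa [add, addC, eq] using beta2 (Δ := Δ) (recr x0 x1 (lam (lam (succ x1)))) a b
theorem add_zero : Pr Δ (eq0 (add a zero) a) := eq0_trans add_eq (epra (.recZero _ _))
theorem add_succ : Pr Δ (eq0 (add a (succ b)) (succ (add a b))) :=
  eq0_trans add_eq (eq0_trans ((recr_lam_succ (b := b) (a := a) (succ x1)).cast) (succ_congr (eq0_symm add_eq)))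

theorem tsub_eq : Pr Δ (eq0 (tsub a b) (recr b a (lam (lam (pred x1))))) := by
  simpa [tsub, subC, eq] using beta2 (Δ := Δ) (recr x0 x1 (lam (lam (pred x1)))) a b
theorem tsub_zero : Pr Δ (eq0 (tsub a zero) a) := eq0_trans tsub_eq (epra (.recZero _ _))
theorem tsub_succ : Pr Δ (eq0 (tsub a (succ b)) (pred (tsub a b))) :=
  eq0_trans tsub_eq (eq0_trans ((recr_lam_succ (b := b) (a := a) (pred x1)).cast) (pred_congr (eq0_symm tsub_eq)))

theorem succ_ne_zero {φ : Fm Γ} (h : Pr Δ (eq0 (succ a) zero)) : Pr Δ φ :=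
  efq ((epra (.succNe a)).negE h)

/-- Every number is zero or the successor of its predecessor. -/
theorem zero_or_succ (a : Tm Γ T0) :
    Pr Δ (or (eq0 a zero) (eq0 a (succ (pred a)))) := by
  refine (ind (Γ := Γ) (Δ := Δ) (or (eq0 x0 zero) (eq0 x0 (succ (pred x0)))) ⟨trivial, trivial⟩
    (orL (refl _)) (orR ?_) a).cast
  exact (succ_congr (eq0_symm (pred_succ (a := x0)))).cast

theorem casesOn {φ : Fm Γ} (a : Tm Γ T0) (hz : Pr (eq0 a zero :: Δ) φ)
    (hs : Pr (eq0 a (succ (pred a)) :: Δ) φ) : Pr Δ φ := (zero_or_succ a).orE hz hs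

/-- Subtraction recurses on its second argument, hence the induction on `b`. Since order is
vanishing of subtraction, this drives the lemmas on successors below. -/
theorem tsub_succ_succ : Pr Δ (eq0 (tsub (succ a) (succ b)) (tsub a b)) := by
  refine (ind (Γ := Γ) (Δ := Δ) (eq0 (tsub (succ (a.wk T0)) (succ x0)) (tsub (a.wk T0) x0)) trivial ?_ ?_ b).cast
  · refine cast (φ := eq0 (tsub (succ a) (succ zero)) (tsub a zero)) ?_
    exact eq0_trans tsub_succ (eq0_trans (pred_congr tsub_zero)
      (eq0_trans pred_succ (eq0_symm tsub_zero)))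
  · refine cast (φ := eq0 (tsub (succ (a.wk T0)) (succ (succ x0))) (tsub (a.wk T0) (succ x0))) ?_
    exact eq0_trans tsub_succ (eq0_trans (pred_congr h0) (eq0_symm tsub_succ))

theorem zero_tsub : Pr Δ (eq0 (tsub zero b) zero) := by
  refine (ind (Γ := Γ) (Δ := Δ) (eq0 (tsub zero x0) zero) trivial ((tsub_zero (a := zero)).cast) ?_ b).cast
  refine cast (φ := eq0 (tsub zero (succ x0)) zero) ?_
  exact eq0_trans tsub_succ (eq0_trans (pred_congr h0) pred_zero)

theorem le_refl (a : Tm Γ T0) : Pr Δ (le a a) := by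
  refine (ind (Γ := Γ) (Δ := Δ) (le x0 x0) trivial ((tsub_zero (a := zero)).cast (by simp [le])) ?_ a).cast
  refine cast (φ := le (succ x0) (succ x0)) ?_
  exact eq0_trans tsub_succ_succ h0

theorem le_succ (h : Pr Δ (le a b)) : Pr Δ (le a (succ b)) :=
  eq0_trans tsub_succ (eq0_trans (pred_congr h) pred_zero)

theorem le_of_succ_le (h : Pr Δ (le (succ a) b)) : Pr Δ (le a b) :=
  eq0_trans (eq0_symm tsub_succ_succ) (le_succ h)

theorem succ_le_succ (h : Pr Δ (le a b)) : Pr Δ (le (succ a) (succ b)) :=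
  eq0_trans tsub_succ_succ h

theorem le_of_succ_le_succ (h : Pr Δ (le (succ a) (succ b))) : Pr Δ (le a b) :=
  eq0_trans (eq0_symm tsub_succ_succ) h

theorem succ_le_self {φ : Fm Γ} (h : Pr Δ (le (succ a) a)) : Pr Δ φ := by
  -- The difference is exactly $1$, by induction, so it cannot vanish.
  have key : Pr Δ (eq0 (tsub (succ a) a) (succ zero)) := by
    refine (ind (Γ := Γ) (Δ := Δ) (eq0 (tsub (succ x0) x0) (succ zero)) trivial ((tsub_zero (a := succ zero)).cast) ?_ a).cast
    refine cast (φ := eq0 (tsub (succ (succ x0)) (succ x0)) (succ zero)) ?_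
    exact eq0_trans tsub_succ_succ h0
  exact succ_ne_zero (eq0_trans (eq0_symm key) h)

theorem zero_add : Pr Δ (eq0 (add zero b) b) := by
  refine (ind (Γ := Γ) (Δ := Δ) (eq0 (add zero x0) x0) trivial ((add_zero (a := zero)).cast) ?_ b).cast
  refine cast (φ := eq0 (add zero (succ x0)) (succ x0)) ?_
  exact eq0_trans add_succ (succ_congr h0)

theorem succ_add : Pr Δ (eq0 (add (succ a) b) (succ (add a b))) := by
  refine (ind (Γ := Γ) (Δ := Δ) (eq0 (add (succ (a.wk T0)) x0) (succ (add (a.wk T0) x0))) trivial ?_ ?_ b).cast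
  · exact (eq0_trans (add_zero (a := succ a)) (succ_congr (eq0_symm add_zero))).cast
  · refine cast (φ := eq0 (add (succ (a.wk T0)) (succ x0)) (succ (add (a.wk T0) (succ x0)))) ?_
    exact eq0_trans add_succ (eq0_trans (succ_congr h0) (succ_congr (eq0_symm add_succ)))

theorem le_add_left (h : Pr Δ (le a b)) : Pr Δ (le a (add c b)) := by
  refine (ind (Γ := Γ) (Δ := Δ) (le (a.wk T0) (add x0 (b.wk T0))) trivial ?_ ?_ c).cast
  · exact (le_congr (refl a) (eq0_symm zero_add) h).cast
  · refine cast (φ := le (a.wk T0) (add (succ x0) (b.wk T0))) ?_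
    exact le_congr (refl _) (eq0_symm succ_add) (le_succ h0)

theorem le_add_right (h : Pr Δ (le a b)) : Pr Δ (le a (add b c)) := by
  refine (ind (Γ := Γ) (Δ := Δ) (le (a.wk T0) (add (b.wk T0) x0)) trivial ?_ ?_ c).cast
  · exact (le_congr (refl a) (eq0_symm add_zero) h).cast
  · refine cast (φ := le (a.wk T0) (add (b.wk T0) (succ x0))) ?_
    exact le_congr (refl _) (eq0_symm add_succ) (le_succ h0)

/-- Turns an inequality into an additive equation, from which transitivity and trichotomy follow
without further induction. -/
theorem eq_tsub_add (h : Pr Δ (le b a)) : Pr Δ (eq0 a (add (tsub a b) b)) := by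
  refine (ind (Γ := Γ) (Δ := Δ) (imp (le x0 (a.wk T0)) (eq0 (a.wk T0) (add (tsub (a.wk T0) x0) x0)))
    ⟨trivial, trivial⟩ (impI ?_) ?_ b).cast (ψ := imp (le b a) _) |>.mp h
  · exact (eq0_symm (eq0_trans add_zero (tsub_zero (a := a)))).cast
  · refine cast (φ := imp (le (succ x0) (a.wk T0))
      (eq0 (a.wk T0) (add (tsub (a.wk T0) (succ x0)) (succ x0)))) (impI ?_)
    have ha : Pr (le (succ x0) (a.wk T0) ::
        imp (le x0 (a.wk T0)) (eq0 (a.wk T0) (add (tsub (a.wk T0) x0) x0)) ::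
          Δ.map (Fm.ren (Ren.wk T0))) (eq0 (a.wk T0) (add (tsub (a.wk T0) x0) x0)) :=
      h1.mp (le_of_succ_le h0)
    -- If $a-x$ is zero then $a=x$, against $x+1\le a$; otherwise one unit moves from the difference
    -- to the other summand.
    refine casesOn (tsub (a.wk T0) x0) ?_ ?_
    · have h : Pr _ (eq0 (a.wk T0) x0) :=
        eq0_trans ha.w (eq0_trans (add_congr h0 (refl _)) zero_add)
      exact succ_le_self (le_congr (refl _) h h1)
    · refine eq0_trans ha.w (eq0_trans (add_congr h0 (refl _)) (eq0_trans succ_add ?_))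
      exact eq0_trans (succ_congr (add_congr (eq0_symm tsub_succ) (refl _))) (eq0_symm add_succ)

theorem eq_or_lt (h : Pr Δ (le a b)) : Pr Δ (or (eq0 a b) (le (succ a) b)) := by
  refine casesOn (tsub b a) (orL ?_) (orR ?_)
  · exact eq0_symm (eq0_trans (eq_tsub_add h.w) (eq0_trans (add_congr h0 (refl _)) zero_add))
  · refine le_congr (refl _) (eq0_symm ?_) (succ_le_succ (le_add_left (c := pred (tsub b a)) (le_refl a)))
    exact eq0_trans (eq_tsub_add h.w) (eq0_trans (add_congr h0 (refl _)) succ_add)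

theorem le_trans (h : Pr Δ (le a b)) (h' : Pr Δ (le b c)) : Pr Δ (le a c) :=
  le_congr (refl _) (eq0_symm (eq_tsub_add h')) (le_add_left h)

theorem le_total (a b : Tm Γ T0) : Pr Δ (or (le a b) (le b a)) := by
  refine (ind (Γ := Γ) (Δ := Δ) (or (le (a.wk T0) x0) (le x0 (a.wk T0))) ⟨trivial, trivial⟩ (orR ?_)
    ?_ b).cast
  · exact (zero_tsub (b := a)).cast (by simp [le])
  refine cast (φ := or (le (a.wk T0) (succ x0)) (le (succ x0) (a.wk T0))) ?_
  refine h0.orE (orL (le_succ h0)) ((eq_or_lt h0).orE (orL ?_) (orR h0))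
  exact le_succ (le_congr h0 (refl _) (le_refl _))

end Arithmetic
end Pr

/-! ### Bounds of finite sequences of numbers -/

/-- The sum of the components of a finite sequence of numbers. -/
@[irreducible] def boundC : Tm [] (Ty.seq T0 ⇒ T0) :=
  lam (recr (len x0) zero (lam (lam (add x1 (get x2 x0)))))
def bound {Γ : Ctx} (Q : Tm Γ (Ty.seq T0)) : Tm Γ T0 := boundC.cl ⬝ Q

@[simp] theorem bound_sub {Γ Γ' : Ctx} (s : Sub Γ Γ') (Q : Tm Γ (Ty.seq T0)) :
    (bound Q).sub s = bound (Q.sub s) := by simp [bound]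
@[simp] theorem bound_ren {Γ Γ' : Ctx} (r : Ren Γ Γ') (Q : Tm Γ (Ty.seq T0)) :
    (bound Q).ren r = bound (Q.ren r) := by simp [bound]

namespace Pr

variable {Γ : Ctx} {Δ : List (Fm Γ)} {σ τ : Ty}

theorem exInE {Q : Tm Γ (Ty.seq σ)} {φ : Fm (σ :: Γ)} {χ : Fm Γ} (h : Pr Δ (exIn Q φ))
    (h' : Pr (φ :: mem x0 (Q.wk σ) :: Δ.map (Fm.ren (Ren.wk σ))) (χ.ren (Ren.wk σ))) :
    Pr Δ χ := by
  refine exE h (cut h0.andL (cut h1.andR (h'.weaken ?_)))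
  intro ψ hψ
  simp only [List.mem_cons] at hψ ⊢
  tauto

/-- Each component is a summand of the sum, and the other summands only increase it. -/
theorem get_le_bound {Q : Tm Γ (Ty.seq T0)} {i : Tm Γ T0} (h : Pr Δ (lt i (len Q))) :
    Pr Δ (le (get Q i) (bound Q)) := by
  -- Generalised to the partial sum of the first $j$ components, so that induction on $j$ applies to
  -- a quantifier-free formula.
  have key : ∀ j : Tm Γ T0, Pr Δ (imp (lt i j)
      (le (get Q i) (recr j zero (lam (lam (add x1 (get ((Q.wk T0).wk T0) x0))))))) := by
    intro j
    refine (ind (Γ := Γ) (Δ := Δ) (imp (lt (i.wk T0) x0) (le (get (Q.wk T0) (i.wk T0))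
      (recr x0 zero (lam (lam (add x1 (get (((Q.wk T0).wk T0).wk T0) x0)))))))
      ⟨trivial, trivial⟩ ?_ ?_ j).cast
    · refine cast (φ := imp (lt i zero) (le (get Q i) (recr zero zero
        (lam (lam (add x1 (get ((Q.wk T0).wk T0) x0))))))) (impI ?_)
      exact succ_ne_zero (eq0_trans (eq0_symm tsub_zero) h0)
    · refine cast (φ := imp (lt (i.wk T0) (succ x0)) (le (get (Q.wk T0) (i.wk T0)) (recr (succ x0)
        zero (lam (lam (add x1 (get (((Q.wk T0).wk T0).wk T0) x0))))))) (impI ?_)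
      refine le_congr (refl _) (eq0_symm (recr_lam_succ _)) ?_
      refine cast (φ := le (get (Q.wk T0) (i.wk T0)) (add (recr x0 zero
        (lam (lam (add x1 (get (((Q.wk T0).wk T0).wk T0) x0))))) (get (Q.wk T0) x0))) ?_
      refine (eq_or_lt (le_of_succ_le_succ h0)).orE ?_ ?_
      · exact le_congr (ext (σ := T0) (τ := T0) _ (eq0_symm h0)) (refl _)
          (le_add_left (le_refl _))
      · exact le_add_right (h2.mp h0)
  refine le_congr (refl _) (eq0_symm ?_) ((key (len Q)).mp h)
  simpa [bound, boundC, eq] using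
    beta (Δ := Δ) (recr (len x0) zero (lam (lam (add x1 (get x2 x0))))) Q

theorem mem_le_bound {Q : Tm Γ (Ty.seq T0)} {z : Tm Γ T0} (h : Pr Δ (mem z Q)) :
    Pr Δ (le z (bound Q)) := by
  refine exE h (cast (φ := le (z.wk T0) (bound (Q.wk T0))) ?_)
  exact le_congr h0.andR (refl _) (get_le_bound h0.andL)

/-! ### Standard objects -/

theorem st_app {f : Tm Γ (σ ⇒ τ)} {a : Tm Γ σ} (h : Pr Δ (st f)) (h' : Pr Δ (st a)) :
    Pr Δ (st (f ⬝ a)) := (ax (.stApp f a)).mp (h.andI h')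
theorem st_cl (t : Tm [] σ) : Pr Δ (st t.cl) := ax (.stClosed t)
theorem st_eq {a b : Tm Γ σ} (h : Pr Δ (st a)) (h' : Pr Δ (eq σ a b)) : Pr Δ (st b) :=
  (ax (.stEq a b)).mp (h.andI h')
theorem st_of_le {m n : Tm Γ T0} (h : Pr Δ (st m)) (h' : Pr Δ (le n m)) : Pr Δ (st n) :=
  (ax (.stBelow n m)).mp (h.andI h')
theorem st_zero : Pr Δ (st zero) := st_cl zero
theorem st_succ {n : Tm Γ T0} (h : Pr Δ (st n)) : Pr Δ (st (succ n)) :=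
  st_app (st_cl (Tm.con Con.succ)) h
theorem st_bound {Q : Tm Γ (Ty.seq T0)} (h : Pr Δ (st Q)) : Pr Δ (st (bound Q)) :=
  st_app (st_cl boundC) h

/-- The elements of a standard finite sequence are standard. -/
theorem st_mem {Q : Tm Γ (Ty.seq σ)} {q : Tm Γ σ} (h : Pr Δ (st Q)) (h' : Pr Δ (mem q Q)) :
    Pr Δ (st q) := by
  refine cut h (exE h'.w (cast (φ := st (q.wk T0)) ?_))
  have hQ : Pr (and (lt x0 (len (Q.wk T0))) (eq σ (get (Q.wk T0) x0) (q.wk T0)) ::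
    st (Q.wk T0) :: Δ.map (Fm.ren (Ren.wk T0))) (st (Q.wk T0)) := h1
  have hi : Pr (and (lt x0 (len (Q.wk T0))) (eq σ (get (Q.wk T0) x0) (q.wk T0)) ::
    st (Q.wk T0) :: Δ.map (Fm.ren (Ren.wk T0))) (st (x0 : Tm (T0 :: Γ) T0)) :=
    st_of_le (st_app (st_cl (Tm.con (Con.len σ))) hQ) (le_of_succ_le h0.andL)
  exact st_eq (st_app (st_app (st_cl (Tm.con (Con.get σ))) hQ) hi) h0.andR

theorem hac {ρ : Ty} {φ : Fm (τ :: ρ :: Γ)} (hφ : φ.Internal) (h : Pr Δ (allSt ρ (exSt τ φ))) :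
    Pr Δ (exSt (ρ ⇒ Ty.seq τ) (allSt ρ
      (exIn (x1 ⬝ x0) (φ.ren (((Ren.wk (ρ ⇒ Ty.seq τ)).lift ρ).lift τ))))) :=
  (ax (.hac φ hφ)).mp h

theorem ideal {φ : Fm (σ :: τ :: Γ)} (hφ : φ.Internal)
    (h : Pr Δ (allSt (Ty.seq σ) (ex τ
      (allIn x1 (φ.ren (((Ren.wk (Ty.seq σ)).lift τ).lift σ)))))) :
    Pr Δ (ex τ (allSt σ φ)) :=
  (ax (.ideal φ hφ)).mp h

/-! ### Monotonicity and use of $A$, $B$ and monotone convergence. -/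

theorem le_of_eq0 {a b : Tm Γ T0} (h : Pr Δ (eq0 a b)) : Pr Δ (le a b) :=
  le_congr (refl _) h (le_refl _)

/-- Together with `fmB_mono` this lets the finitely many values supplied by Herbrandised choice be
replaced by a single upper bound. -/
theorem fmA_mono {f : Tm Γ T1} {m n : Tm Γ T0} (h : Pr Δ (fmA f m)) (hl : Pr Δ (le m n)) :
    Pr Δ (fmA f n) := by
  refine cut h (cut hl.w (impI ((h2.mp h0).exE (exI x0 ?_))))
  refine cast (φ := and (le x0 (n.wk T0)) (eq0 (f.wk T0 ⬝ x0) zero)) (andI ?_ h0.andR)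
  exact le_trans h0.andL (h2 (a := Fm.ren (Ren.wk T0) (le m n))).cast

theorem fmB_mono {c : Tm Γ TS} {k m n : Tm Γ T0} (h : Pr Δ (fmB c k m)) (hl : Pr Δ (le m n)) :
    Pr Δ (fmB c k n) := by
  refine cut h (cut hl.w (impI (cut (h2.mp h0) (allI (impI (allI (impI ?_)))))))
  refine cut (h4 (a := ((le m n).ren (Ren.wk T0)).ren (Ren.wk T0)).cast
    (ψ := le ((m.wk T0).wk T0) ((n.wk T0).wk T0))) ?_
  refine cut (h2 (a := (le (n.wk T0) x0).ren (Ren.wk T0)).cast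
    (ψ := le ((n.wk T0).wk T0) x1)) ?_
  refine cut (((h4.allE x1).cast (ψ := imp (le ((m.wk T0).wk T0) x1) (all T0
    (imp (le (((m.wk T0).wk T0).wk T0) x0) (realNear ((((c.wk T0).wk T0).wk T0) ⬝ x0)
      ((((c.wk T0).wk T0).wk T0) ⬝ x2) (((k.wk T0).wk T0).wk T0)))))).mp (le_trans h1 h0)) ?_
  exact ((h0.allE x0).cast (ψ := imp (le ((m.wk T0).wk T0) x0) (realNear
    (((c.wk T0).wk T0) ⬝ x0) (((c.wk T0).wk T0) ⬝ x1) ((k.wk T0).wk T0)))).mp (le_trans h2 h3)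

theorem fmB_near {c : Tm Γ TS} {k m M N : Tm Γ T0} (h : Pr Δ (fmB c k m))
    (hc : Pr Δ (incrBdd c)) (hN : Pr Δ (le m N)) (hM : Pr Δ (le m M)) :
    Pr Δ (realNear (c ⬝ M) (c ⬝ N) k) := by
  have h1 := ((h.mp hc).allE N).cast (ψ := imp (le m N) (all T0 (imp (le (m.wk T0) x0)
    (realNear (c.wk T0 ⬝ x0) (c.wk T0 ⬝ N.wk T0) (k.wk T0)))))
  exact (((h1.mp hN).allE M).cast (ψ := imp (le m M) _)).mp hM

/-- Nonstandard numbers exceed all standard ones. -/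
theorem le_of_not_st {m N : Tm Γ T0} (hm : Pr Δ (st m)) (hN : Pr Δ (neg (st N))) :
    Pr Δ (le m N) :=
  (le_total m N).orE h0 (efq (hN.w.negE (st_of_le hm.w h0)))

/-- The first assumption is `MCTns` spelled out, so that it is available in any context of free
variables. -/
theorem near_of_mct (h : Pr Δ (allSt TS (imp (incrBdd x0) (all T0 (imp (neg (st x0))
      (all T0 (imp (neg (st x0)) (realApprox (x2 ⬝ x0) (x2 ⬝ x1)))))))))
    {c : Tm Γ TS} {k M N : Tm Γ T0} (hst : Pr Δ (st c)) (hc : Pr Δ (incrBdd c))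
    (hN : Pr Δ (neg (st N))) (hM : Pr Δ (neg (st M))) (hk : Pr Δ (st k)) :
    Pr Δ (realNear (c ⬝ M) (c ⬝ N) k) := by
  have h1 := (h.allE c).cast (ψ := imp (st c) (imp (incrBdd c) (all T0 (imp (neg (st x0))
    (all T0 (imp (neg (st x0)) (realApprox ((c.wk T0).wk T0 ⬝ x0) ((c.wk T0).wk T0 ⬝ x1))))))))
  have h2 := (((h1.mp hst).mp hc).allE N).cast (ψ := imp (neg (st N))
    (all T0 (imp (neg (st x0)) (realApprox (c.wk T0 ⬝ x0) (c.wk T0 ⬝ N.wk T0)))))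
  have h3 := ((h2.mp hN).allE M).cast (ψ := imp (neg (st M)) (realApprox (c ⬝ M) (c ⬝ N)))
  exact (((h3.mp hM).allE k).cast (ψ := imp (st k) _)).mp hk

end Pr

/-! ### Pairs -/

/-- The type of (Church) pairs of a sequence of reals and a number. -/
abbrev TP : Ty := (TS ⇒ T0 ⇒ T0) ⇒ T0

/-- `λ c k p. p c k`. -/
@[irreducible] def churchC : Tm [] (TS ⇒ T0 ⇒ TP) := lam (lam (lam (x0 ⬝ x2 ⬝ x1)))
/-- `λ p n j. p (λ c k. c n j)`. -/
@[irreducible] def churchFstC : Tm [] (TP ⇒ TS) :=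
  lam (lam (lam (x2 ⬝ lam (lam (x1 ⬝ x3 ⬝ x2)))))
/-- `λ p. p (λ c k. k)`. -/
@[irreducible] def churchSndC : Tm [] (TP ⇒ T0) := lam (x0 ⬝ lam (lam x0))

namespace Pr

variable {Γ : Ctx} {Δ : List (Fm Γ)} (c : Tm Γ TS) (k : Tm Γ T0)

theorem church_app (p : Tm Γ (TS ⇒ T0 ⇒ T0)) :
    Pr Δ (eq0 (churchC.cl ⬝ c ⬝ k ⬝ p) (p ⬝ c ⬝ k)) := by
  have h1 : Pr Δ (eq TP (churchC.cl ⬝ c ⬝ k) (lam (x0 ⬝ c.wk _ ⬝ k.wk _))) := by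
    simpa [churchC] using beta2 (Δ := Δ) (lam (x0 ⬝ x2 ⬝ x1) : Tm (T0 :: TS :: Γ) TP) c k
  have h2 := beta (Δ := Δ) (x0 ⬝ c.wk _ ⬝ k.wk _) p
  simp only [Tm.sub_app, Tm.sub_tvar, Sub.one_vz, Tm.wk_sub_one] at h2
  exact eq_trans (eq_app h1 p) h2

theorem church_snd : Pr Δ (eq0 (churchSndC.cl ⬝ (churchC.cl ⬝ c ⬝ k)) k) := by
  have h1 : Pr Δ (eq0 (churchSndC.cl ⬝ (churchC.cl ⬝ c ⬝ k))
      (churchC.cl ⬝ c ⬝ k ⬝ lam (lam x0))) := by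
    simpa [churchSndC, eq] using
      beta (Δ := Δ) (x0 ⬝ lam (lam x0) : Tm (TP :: Γ) T0) (churchC.cl ⬝ c ⬝ k)
  have h2 : Pr Δ (eq0 (lam (lam x0) ⬝ c ⬝ k) k) := beta2 (τ := T0) x0 c k
  exact eq0_trans h1 (eq0_trans (church_app c k _) h2)

/-- Such a pair eliminates only into numbers, so its first component is recovered value by value, at
each $n$ and $j$. -/
theorem church_fst_app (n j : Tm Γ T0) :
    Pr Δ (eq0 (churchFstC.cl ⬝ (churchC.cl ⬝ c ⬝ k) ⬝ n ⬝ j) (c ⬝ n ⬝ j)) := by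
  have h1 : Pr Δ (eq T1 (churchFstC.cl ⬝ (churchC.cl ⬝ c ⬝ k) ⬝ n)
      (lam ((churchC.cl ⬝ c ⬝ k).wk _ ⬝ lam (lam (x1 ⬝ ((n.wk _).wk _).wk _ ⬝ x2))))) := by
    simpa [churchFstC] using beta2 (Δ := Δ)
      (lam (x2 ⬝ lam (lam (x1 ⬝ x3 ⬝ x2))) : Tm (T0 :: TP :: Γ) T1) (churchC.cl ⬝ c ⬝ k) n
  have h2 : Pr Δ (eq0 _ (churchC.cl ⬝ c ⬝ k ⬝ lam (lam (x1 ⬝ (n.wk _).wk _ ⬝ (j.wk _).wk _)))) :=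
    eq0_trans (eq_app h1 j) ((beta (τ := T0)
      ((churchC.cl ⬝ c ⬝ k).wk _ ⬝ lam (lam (x1 ⬝ ((n.wk _).wk _).wk _ ⬝ x2))) j).cast (by simp [eq]))
  have h3 : Pr Δ (eq0 (lam (lam (x1 ⬝ (n.wk _).wk _ ⬝ (j.wk _).wk _)) ⬝ c ⬝ k) (c ⬝ n ⬝ j)) :=
    (beta2 (τ := T0) (x1 ⬝ (n.wk _).wk _ ⬝ (j.wk _).wk _) c k).cast (by simp [eq])
  exact eq0_trans h2 (eq0_trans (church_app c k _) h3)

theorem church_fst : Pr Δ (eq TS (churchFstC.cl ⬝ (churchC.cl ⬝ c ⬝ k)) c) :=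
  allI (allI (cast (church_fst_app (c.ren (Ren.wk T0) |>.ren (Ren.wk T0))
    (k.ren (Ren.wk T0) |>.ren (Ren.wk T0)) x1 x0) (by simp [eq])))

/-- Pairs are decoded only up to extensional equality, so $B$ has to be transported along it. -/
theorem fmB_replace {c c' : Tm Γ TS} {k k' : Tm Γ T0} (m : Tm Γ T0) (hc : Pr Δ (eq TS c c'))
    (hk : Pr Δ (eq0 k k')) (h : Pr Δ (fmB c k m)) : Pr Δ (fmB c' k' m) := by
  let s : Tm Γ TS → Tm Γ T0 → Sub [T0, T0, TS] Γ := fun c k τ v => match τ, v with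
    | _, .vz => m
    | _, .vs .vz => k
    | _, .vs (.vs .vz) => c
  refine cut h (cut hc.w (cut hk.w.w ?_))
  refine ((replace (fmB x2 x1 x0) (s := s c k) (s' := s c' k') ?_).1.mp (h2.cast ?_)).cast ?_
  · rintro τ (_ | _ | _ | ⟨⟨⟩⟩)
    · exact .inl rfl
    · exact .inr List.mem_cons_self
    · exact .inr (List.mem_cons_of_mem _ List.mem_cons_self)
  · simp; rfl
  · simp; rfl

end Pr

abbrev x5 {Γ : Ctx} {a b c d e f : Ty} : Tm (a :: b :: c :: d :: e :: f :: Γ) f :=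
  Tm.var (.vs (.vs (.vs (.vs (.vs .vz)))))
abbrev x6 {Γ : Ctx} {a b c d e f g : Ty} : Tm (a :: b :: c :: d :: e :: f :: g :: Γ) g :=
  Tm.var (.vs (.vs (.vs (.vs (.vs (.vs .vz))))))
abbrev x7 {Γ : Ctx} {a b c d e f g h : Ty} :
    Tm (a :: b :: c :: d :: e :: f :: g :: h :: Γ) h :=
  Tm.var (.vs (.vs (.vs (.vs (.vs (.vs (.vs .vz)))))))

theorem Fm.Internal.fmA {Γ : Ctx} (f : Tm Γ T1) (n : Tm Γ T0) : (fmA f n).Internal :=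
  ⟨trivial, trivial, trivial⟩

theorem Fm.Internal.fmB {Γ : Ctx} (c : Tm Γ TS) (k m : Tm Γ T0) : (fmB c k m).Internal := by
  simp [Fm.fmB, Fm.Internal, incrBdd, realLe, realNear, le, lt]

/-! ### From transfer to monotone convergence -/

/-- `λ F f. bound (F f)`. -/
@[irreducible] def boundAppC : Tm [] ((T1 ⇒ Ty.seq T0) ⇒ T2) := lam (lam (bound (x1 ⬝ x0)))

/-- `λ F c k. bound (F (c, k))`. -/
@[irreducible] def boundPairC : Tm [] ((TP ⇒ Ty.seq T0) ⇒ TS ⇒ T1) :=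
  lam (lam (lam (bound (x2 ⬝ (churchC.cl ⬝ x1 ⬝ x0)))))

namespace Pr

theorem boundApp_eq {Γ : Ctx} {Δ : List (Fm Γ)} (F : Tm Γ (T1 ⇒ Ty.seq T0)) (f : Tm Γ T1) :
    Pr Δ (eq0 (boundAppC.cl ⬝ F ⬝ f) (bound (F ⬝ f))) := by
  simpa [boundAppC, eq] using beta2 (Δ := Δ) (bound (x1 ⬝ x0)) F f

theorem boundPair_eq {Γ : Ctx} {Δ : List (Fm Γ)} (F : Tm Γ (TP ⇒ Ty.seq T0)) (c : Tm Γ TS)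
    (k : Tm Γ T0) :
    Pr Δ (eq0 (boundPairC.cl ⬝ F ⬝ c ⬝ k) (bound (F ⬝ (churchC.cl ⬝ c ⬝ k)))) := by
  have h1 : Pr Δ (eq T1 (boundPairC.cl ⬝ F ⬝ c)
      (lam (bound (F.wk _ ⬝ (churchC.cl ⬝ c.wk _ ⬝ x0))))) := by
    simpa [boundPairC] using
      beta2 (Δ := Δ) (lam (bound (x2 ⬝ (churchC.cl ⬝ x1 ⬝ x0)))) F c
  exact eq0_trans (eq_app h1 k)
    ((beta (τ := T0) (bound (F.wk _ ⬝ (churchC.cl ⬝ c.wk _ ⬝ x0))) k).cast (by simp [eq]))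

/-- Case distinction on whether the standard $f$ has a standard zero. -/
theorem exists_st_fmA_of_trans :
    Pr [TRANS] (allSt T1 (exSt T0 (fmA x1 x0))) := by
  refine allI (impI (cases (ex T0 (and (st x0) (eq0 (x1 ⬝ x0) zero))) ?_ ?_))
  · refine h0.exE (exI x0 ?_)
    refine cast (φ := and (st x0) (fmA x1 x0)) (andI h0.andL (impI (exI x0 ?_)))
    exact cast (φ := and (le x0 x0) (eq0 (x1 ⬝ x0) zero)) (andI (le_refl _) h1.andR)
  -- Without a standard zero, transfer excludes all zeros; the premise of $A$ fails, and any
  -- standard bound would do.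
  · refine exI zero (cast (φ := and (st zero) (fmA x0 zero)) (andI st_zero (impI (efq ?_))))
    refine h0.exE ?_
    refine cut (((h4.allE x1).cast (ψ := imp (st x1) (imp (allSt T0 (neg (eq0 (x2 ⬝ x0) zero)))
      (all T0 (neg (eq0 (x2 ⬝ x0) zero)))))).mp h3) ?_
    refine ((h0.mp ?_).allE x0).cast (ψ := neg (eq0 (x1 ⬝ x0) zero)) |>.negE h1
    refine allI (impI (impI ?_))
    exact h5.negE (exI x0 (andI h1 h0))

theorem exists_st_functional_of_trans :
    Pr [TRANS] (exSt T2 (allSt T1 (fmA x0 (x1 ⬝ x0)))) := by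
  refine (hac (Internal.fmA _ _) exists_st_fmA_of_trans).exE (exI (boundAppC.cl ⬝ x0) ?_)
  refine cast (φ := and (st (boundAppC.cl ⬝ x0)) (allSt T1 (fmA x0 (boundAppC.cl ⬝ x1 ⬝ x0))))
    (andI (st_app (st_cl _) h0.andL) (allI (impI ?_)))
  refine exInE (((h1.andR.allE x0).cast
    (ψ := imp (st x0) (exIn (x1 ⬝ x0) (fmA x1 x0)))).mp h0) ?_
  refine cast (φ := fmA x1 (boundAppC.cl ⬝ x2 ⬝ x1)) ?_
  exact fmA_mono h0 (le_trans (mem_le_bound h1) (le_of_eq0 (eq0_symm (boundApp_eq _ _))))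

/-- All inputs of $t_1,t_2$ are standard, so the threshold $m$ and the test function $f$ are
standard elements; the choice of $\mu$ then provides the premise $A(f,\mu(f))$. -/
theorem mct_of_trans (t₁ : Tm [] (T2 ⇒ TS ⇒ T0 ⇒ Ty.seq T0))
    (t₂ : Tm [] (T2 ⇒ TS ⇒ T0 ⇒ Ty.seq T1)) (hM : Pr [] (MTEfwd t₁ t₂)) :
    Pr [TRANS] MCTns := by
  refine cut (hM.weaken (List.nil_subset _)) (exE (exists_st_functional_of_trans.w) ?_)
  refine allI (impI (impI (allI (impI (allI (impI (allI (impI ?_))))))))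
  refine cut (allE3 (ψ := exIn (t₁.cl ⬝ x4 ⬝ x3 ⬝ x0) (exIn (t₂.cl ⬝ x5 ⬝ x4 ⬝ x1)
    (imp (fmA x0 (x6 ⬝ x0)) (fmB x5 x2 x1)))) h6 x3 x0 x4) ?_
  refine exInE h0 (exInE h0 ?_)
  refine cast (φ := realNear (x5 ⬝ x3) (x5 ⬝ x4) x2) ?_
  refine cut (hyp (φ := and (st x6) (allSt T1 (fmA x0 (x7 ⬝ x0)))) (by simp)) ?_
  refine cut (hyp (φ := st x2) (by simp)) (cut (hyp (φ := st x5) (by simp)) ?_)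
  refine cut (st_mem (q := x1) (Q := t₁.cl ⬝ x6 ⬝ x5 ⬝ x2) (st_app (st_app (st_app (st_cl _)
    h2.andL) h0) h1) (hyp (by simp))) ?_
  refine cut (st_mem (q := x0) (Q := t₂.cl ⬝ x6 ⬝ x5 ⬝ x2) (st_app (st_app (st_app (st_cl _)
    h3.andL) h1) h2) (hyp (by simp))) ?_
  refine fmB_near (m := x1) ?_ (hyp (by simp)) (le_of_not_st h1 (hyp (by simp)))
    (le_of_not_st h1 (hyp (by simp)))
  refine (hyp (by simp) : Pr _ (imp (fmA x0 (x6 ⬝ x0)) (fmB x5 x2 x1))).mp ?_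
  exact ((h4.andR.allE x0).cast (ψ := imp (st x0) (fmA x0 (x6 ⬝ x0)))).mp h0

/-! ### From monotone convergence to transfer -/

/-- By contradiction through idealisation. Induction would not give a least threshold, as $B$ is not
quantifier-free. -/
theorem exists_st_fmB_of_mct : Pr [MCTns] (allSt TS (allSt T0 (exSt T0 (fmB x2 x1 x0)))) := by
  refine allI (impI (allI (impI (raa ?_))))
  -- The first conjunct makes the ideal object exceed every standard number; the second ignores the
  -- standard variable.
  refine (ideal (σ := T0) (τ := T0) (φ := and (lt x0 x1) (neg (fmB x3 x2 x1)))
    (by simp [Internal, lt, le, neg, Internal.fmB]) ?_).exE ?_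
  -- One more than the sum of a standard finite sequence exceeds all its elements and is itself
  -- standard, so $B$ fails there by assumption.
  · refine allI (impI (exI (succ (bound x0)) ?_))
    refine cast (φ := allIn x0 (and (lt x0 (succ (bound x1))) (neg (fmB x3 x2 (succ (bound x1))))))
      (allI (impI (andI ?_ (impI ?_))))
    · exact succ_le_succ (mem_le_bound h0)
    · refine negE (φ := exSt T0 (fmB x4 x3 x0)) (hyp (by simp)) (exI (succ (bound x1)) ?_)
      exact cast (φ := and (st (succ (bound x1))) (fmB x3 x2 (succ (bound x1))))
        (andI (st_succ (st_bound (hyp (by simp)))) h0)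
  -- The instance at $0$ serves only to extract the failure of $B$.
  · refine cut ((h0.allE zero).cast (ψ := imp (st zero) (and (lt zero x0) (neg (fmB x2 x1 x0)))))
      ((h0.mp st_zero).andR.negE ?_)
    refine impI (allI (impI (allI (impI ?_))))
    -- A standard $n$ above the ideal number would make that number standard, hence smaller than
    -- itself.
    have hns : ∀ {Δ : List (Fm [T0, T0, T0, T0, TS])} (n : Tm [T0, T0, T0, T0, TS] T0),
        Pr Δ (le x2 n) → Pr Δ (allSt T0 (and (lt x0 x3) (neg (fmB x5 x4 x3)))) →
        Pr Δ (neg (st n)) := by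
      intro Δ n hn h
      refine impI (succ_le_self (a := x2) ?_)
      exact (((h.w.allE x2).cast (ψ := imp (st x2) (and (lt x2 x2) (neg (fmB x4 x3 x2))))).mp
        (st_of_le h0 hn.w)).andL
    refine near_of_mct (hyp (by simp [MCTns])) (hyp (by simp)) (hyp (by simp))
      (hns _ (hyp (by simp)) (hyp (by simp))) (hns _ (hyp (by simp)) (hyp (by simp)))
      (hyp (by simp))

/-- Choice is available for a single standard variable, so $c$ and $k$ are packed into one pair, and
the resulting functional is curried afterwards. -/
theorem exists_st_modulus_of_mct :
    Pr [MCTns] (exSt (TS ⇒ T1) (allSt TS (allSt T0 (fmB x1 x0 (x2 ⬝ x1 ⬝ x0))))) := by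
  have hH : Pr [MCTns] (allSt TP (exSt T0
      (fmB (churchFstC.cl ⬝ x1) (churchSndC.cl ⬝ x1) x0))) := by
    refine cut exists_st_fmB_of_mct (allI (impI ?_))
    refine cut (((h1.allE (churchFstC.cl ⬝ x0)).cast (ψ := imp (st (churchFstC.cl ⬝ x0))
      (allSt T0 (exSt T0 (fmB (churchFstC.cl ⬝ x2) x1 x0))))).mp (st_app (st_cl _) h0)) ?_
    exact ((h0.allE (churchSndC.cl ⬝ x0)).cast (ψ := imp (st (churchSndC.cl ⬝ x0))
      (exSt T0 (fmB (churchFstC.cl ⬝ x1) (churchSndC.cl ⬝ x1) x0)))).mp (st_app (st_cl _) h1)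
  refine (hac (Internal.fmB _ _ _) hH).exE (exI (boundPairC.cl ⬝ x0) ?_)
  refine cast (φ := and (st (boundPairC.cl ⬝ x0))
    (allSt TS (allSt T0 (fmB x1 x0 (boundPairC.cl ⬝ x2 ⬝ x1 ⬝ x0)))))
    (andI (st_app (st_cl _) h0.andL) (allI (impI (allI (impI ?_)))))
  refine cut (hyp (φ := and (st x2) (allSt TP (exIn (x3 ⬝ x0)
    (fmB (churchFstC.cl ⬝ x1) (churchSndC.cl ⬝ x1) x0)))) (by simp)).andR ?_
  refine exInE (((h0.allE (churchC.cl ⬝ x1 ⬝ x0)).cast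
    (ψ := imp (st (churchC.cl ⬝ x1 ⬝ x0)) (exIn (x2 ⬝ (churchC.cl ⬝ x1 ⬝ x0))
      (fmB (churchFstC.cl ⬝ (churchC.cl ⬝ x2 ⬝ x1)) (churchSndC.cl ⬝ (churchC.cl ⬝ x2 ⬝ x1))
        x0)))).mp (st_app (st_app (st_cl _) (hyp (by simp))) (hyp (by simp)))) ?_
  refine cast (φ := fmB x2 x1 (boundPairC.cl ⬝ x3 ⬝ x2 ⬝ x1)) ?_
  exact fmB_mono (fmB_replace _ (church_fst _ _) (church_snd _ _) h0)
    (le_trans (mem_le_bound (Q := x3 ⬝ (churchC.cl ⬝ x2 ⬝ x1)) (hyp (by simp)))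
      (le_of_eq0 (eq0_symm (boundPair_eq _ _ _))))

/-- The standard modulus $g$ satisfies the premise of the backward half at the standard $c$ and $k$
it selects. -/
theorem trans_of_mct (s₁ : Tm [] (T1 ⇒ (TS ⇒ T1) ⇒ Ty.seq T0))
    (s₂ : Tm [] (T1 ⇒ (TS ⇒ T1) ⇒ Ty.seq TS)) (s₃ : Tm [] (T1 ⇒ (TS ⇒ T1) ⇒ Ty.seq T0))
    (hM : Pr [] (MTEbwd s₁ s₂ s₃)) : Pr [MCTns] TRANS := by
  refine cut (hM.weaken (List.nil_subset _)) (exE (exists_st_modulus_of_mct.w) ?_)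
  refine allI (impI (impI (allI (impI ?_))))
  refine cut (allE2 (ψ := exIn (s₁.cl ⬝ x1 ⬝ x2) (exIn (s₂.cl ⬝ x2 ⬝ x3)
    (exIn (s₃.cl ⬝ x3 ⬝ x4) (imp (fmB x1 x0 (x5 ⬝ x1 ⬝ x0)) (fmA x4 x2)))))
    (hyp (φ := MTEbwd s₁ s₂ s₃ |>.ren Ren.empty) (by simp [MTEbwd])) x1 x2) ?_
  refine exInE h0 (exInE h0 (exInE h0 ?_))
  refine cast (φ := bot) ?_
  refine cut (hyp (φ := st x4) (by simp)) ?_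
  refine cut (hyp (φ := and (st x5) (allSt TS (allSt T0 (fmB x1 x0 (x7 ⬝ x1 ⬝ x0))))) (by simp)) ?_
  refine cut (st_mem (q := x2) (Q := s₁.cl ⬝ x4 ⬝ x5) (st_app (st_app (st_cl _) h1) h0.andL)
    (hyp (by simp))) ?_
  refine cut (st_mem (q := x1) (Q := s₂.cl ⬝ x4 ⬝ x5) (st_app (st_app (st_cl _) h2) h1.andL)
    (hyp (by simp))) ?_
  refine cut (st_mem (q := x0) (Q := s₃.cl ⬝ x4 ⬝ x5) (st_app (st_app (st_cl _) h3) h2.andL)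
    (hyp (by simp))) ?_
  refine cut ((h3.andR.allE x1).cast (ψ := imp (st x1) (allSt T0 (fmB x2 x0 (x6 ⬝ x2 ⬝ x0))))
    |>.mp h1) ?_
  refine cut ((h0.allE x0).cast (ψ := imp (st x0) (fmB x1 x0 (x5 ⬝ x1 ⬝ x0))) |>.mp h1) ?_
  refine cut (mp (hyp (φ := imp (fmB x1 x0 (x5 ⬝ x1 ⬝ x0)) (fmA x4 x2)) (by simp)) h0) ?_
  -- The given zero, possibly nonstandard, triggers $A$; the zero returned lies below the standard
  -- $m$, so it is standard and contradicts the hypothesis on $f$.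
  refine (mp (ψ := ex T0 (and (le x0 x3) (eq0 (x5 ⬝ x0) zero))) h0 (exI x3 ?_)).exE ?_
  · exact hyp (φ := eq0 (x4 ⬝ x3) zero) (by simp)
  · refine negE (φ := eq0 (x5 ⬝ x0) zero) ?_ h0.andR
    refine cut (hyp (φ := allSt T0 (neg (eq0 (x6 ⬝ x0) zero))) (by simp)) (mp (φ := st x0) ?_ ?_)
    · exact (h0.allE x0).cast
    · exact st_of_le (m := x3) (hyp (by simp)) h1.andL

end Pr
end Herb
theorem corollary4p2
    (s₁ : Herb.Tm [] (Herb.T1 ⇒ (Herb.TS ⇒ Herb.T1) ⇒ Herb.Ty.seq Herb.T0))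
    (s₂ : Herb.Tm [] (Herb.T1 ⇒ (Herb.TS ⇒ Herb.T1) ⇒ Herb.Ty.seq Herb.TS))
    (s₃ : Herb.Tm [] (Herb.T1 ⇒ (Herb.TS ⇒ Herb.T1) ⇒ Herb.Ty.seq Herb.T0))
    (t₁ : Herb.Tm [] (Herb.T2 ⇒ Herb.TS ⇒ Herb.T0 ⇒ Herb.Ty.seq Herb.T0))
    (t₂ : Herb.Tm [] (Herb.T2 ⇒ Herb.TS ⇒ Herb.T0 ⇒ Herb.Ty.seq Herb.T1)) :
    Nonempty (Herb.Proof Herb.EPRA (Herb.MTEher s₁ s₂ s₃ t₁ t₂) →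
      Herb.Proof Herb.P0 (Herb.Fm.iff Herb.TRANS Herb.MCTns)) := by
  -- `Pr` asserts only that a derivation exists, so choice is used to obtain a map between
  -- derivations.
  refine ⟨fun d => Classical.choice ?_⟩
  have h := Herb.Pr.of_epra d
  exact ((Herb.Pr.mct_of_trans t₁ t₂ h.andL).impI).andI ((Herb.Pr.trans_of_mct s₁ s₂ s₃ h.andR).impI)
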